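/- **Setting.** Let $M$ be a connected Hausdorff smooth finite-dimensional manifold with base point $*$ and $G$ a finite-dimensional Lie group. Paths are continuous piecewise smooth maps $[0,1]\to M$ (smooth on the closed intervals of a finite subdivision); $PM$ is the set of paths $p$ with $p(0)=*$, and $\Omega M$ the set of loops at $*$. For paths, $\alpha\circ\beta$ means first $\beta$, then $\alpha$; $p^{-1}$ is the reversed path; $K(p,i)(j):=p(ij)$. A family $\widetilde\psi:U\to PM$ indexed by an open subset $U$ of a manifold (for instance of $\mathbb R^n$) is smooth if $\psi(u,i)=\widetilde\psi[u](i)$ is continuous on $U\times[0,1]$ and there are $0=i_0<\dots<i_{k+1}=1$ with $\psi$ smooth on every $U\times[i_n,i_{n+1}]$. A loop is thin if it is homotopic to the constant loop, relative to $*$, by a homotopy whose image lies in the image of the loop. Let $H:\Omega M\to G$ satisfy: (1) $H(\alpha\circ\beta)=H(\beta)H(\alpha)$; (2) $H(\gamma)=e$ for every thin loop $\gamma$; (3) for all $n$, all open $U\subseteq\mathbb R^n$ and all smooth families of loops $\widetilde\Omega:U\to\Omega M$, the map $H\circ\widetilde\Omega:U\to G$ is smooth. Let $E:=(PM\times G)/T$,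 where $(p,g)\,T\,(p',g')$ iff $p(1)=p'(1)$ and $g'=H(p^{-1}\circ p')g$; write $\{p,g\}$ for the class of $(p,g)$, $\pi\{p,g\}:=p(1)$ and $R_g\{p,h\}:=\{p,hg\}$. For a contractible open $U\subseteq M$ and a smooth family $\widetilde\psi:U\to PM$ with $\widetilde\psi[u](1)=u$ for all $u\in U$, put $C_\psi:U\times G\to\pi^{-1}(U)$, $C_\psi(u,g):=\{\widetilde\psi[u],g\}$. **Proposition 4.1.** $E$ carries the structure of a smooth manifold (modelled on the product of the model spaces of $M$ and $G$) for which every $\pi^{-1}(U)$ is open and every $C_\psi$ is a diffeomorphism of $U\times G$ onto $\pi^{-1}(U)$. For such a structure, $\pi$ and the right action $E\times G\to E$ are smooth. For $a=\{p,g\}\in E$ let $\Gamma_a\subseteq T_aE$ be the span of all velocity vectors, whenever they exist, $$\frac{d}{di}\{K(r,i),h\}\Big|_{i=j},\qquad h:=H\big(p^{-1}\circ K(r,j)\big)g,$$ where $r\in PM$ and $j\in[0,1]$ satisfy $r(j)=p(1)$ (one-sided derivatives if $j\in\{0,1\}$). Then $\Gamma:a\mapsto\Gamma_a$ is a smooth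 connection on $E$, that is: (a) $\Gamma_a\oplus\ker(\pi_*:T_aE\to T_{\pi(a)}M)=T_aE$ for all $a\in E$; (b) $(R_g)_*\Gamma_a=\Gamma_{R_g a}$ for all $a\in E$, $g\in G$; (c) $\Gamma$ is smooth: locally on $E$ it is spanned by a frame of smooth vector fields. -/

import Mathlib

open Set unitInterval
open scoped Manifold ContDiff Topology

noncomputable section

namespace HolonomyReconstruction

/-! Throughout, `M` is a manifold modelled on a real vector space `EM`, and `G` a Lie group modelled
on a real vector space `EG`. Paths are parametrized by `[0,1]`, and `γ.extend : ℝ → M` is the path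
`γ`, prolonged by constants outside of `[0,1]` (only its values on `[0,1]` are ever used). -/

section Paths

variable (EM : Type*) [NormedAddCommGroup EM] [NormedSpace ℝ EM]
  {M : Type*} [TopologicalSpace M] [ChartedSpace EM M]

/-- A (continuous) path is piecewise smooth if there is a finite set `B` of break points such that it
is smooth on each closed subinterval `[a,b]` of `[0,1]` that has no break point in its interior. -/
def IsPiecewiseSmooth {x y : M} (γ : Path x y) : Prop :=
  ∃ B : Finset ℝ, ∀ a b : ℝ, 0 ≤ a → a < b → b ≤ 1 → (∀ c ∈ B, c ∉ Ioo a b) →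
    ContMDiffOn 𝓘(ℝ, ℝ) 𝓘(ℝ, EM) ∞ γ.extend (Icc a b)

variable {EM}

theorem IsPiecewiseSmooth.symm {x y : M} {γ : Path x y} (h : IsPiecewiseSmooth EM γ) :
    IsPiecewiseSmooth EM γ.symm := by
  classical
  obtain ⟨B, hB⟩ := h
  refine ⟨B.image (fun t => 1 - t), fun a b ha hab hb hc => ?_⟩
  have h1 := hB (1 - b) (1 - a) (by linarith) (by linarith) (by linarith) (fun c hcB hcI =>
    hc (1 - c) (Finset.mem_image_of_mem _ hcB) ⟨by linarith [hcI.2], by linarith [hcI.1]⟩)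
  have h2 : ContMDiffOn 𝓘(ℝ, ℝ) 𝓘(ℝ, ℝ) ∞ (fun t : ℝ => 1 - t) (Icc a b) :=
    (contDiff_const.sub contDiff_id).contMDiff.contMDiffOn
  refine (h1.comp h2 ?_).congr ?_
  · intro t ht
    exact ⟨by linarith [ht.2], by linarith [ht.1]⟩
  · intro t _
    exact γ.extend_symm_apply t

theorem IsPiecewiseSmooth.trans {x y z : M} {γ : Path x y} {δ : Path y z}
    (h : IsPiecewiseSmooth EM γ) (h' : IsPiecewiseSmooth EM δ) :
    IsPiecewiseSmooth EM (γ.trans δ) := by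
  classical
  obtain ⟨B, hB⟩ := h
  obtain ⟨B', hB'⟩ := h'
  refine ⟨{1 / 2} ∪ (B.image (fun t => t / 2) ∪ B'.image (fun t => (t + 1) / 2)),
    fun a b ha hab hb hc => ?_⟩
  have hhalf : b ≤ 1 / 2 ∨ 1 / 2 ≤ a := by
    by_contra! hcon
    exact hc (1 / 2) (by simp) ⟨hcon.2, hcon.1⟩
  rcases hhalf with hb2 | ha2
  · have h1 := hB (2 * a) (2 * b) (by linarith) (by linarith) (by linarith) (fun c hcB hcI =>
      hc (c / 2) (Finset.mem_union_right _ (Finset.mem_union_left _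
        (Finset.mem_image_of_mem _ hcB))) ⟨by linarith [hcI.1], by linarith [hcI.2]⟩)
    have h2 : ContMDiffOn 𝓘(ℝ, ℝ) 𝓘(ℝ, ℝ) ∞ (fun t : ℝ => 2 * t) (Icc a b) :=
      (contDiff_const.mul contDiff_id).contMDiff.contMDiffOn
    refine (h1.comp h2 ?_).congr ?_
    · intro t ht
      exact ⟨by linarith [ht.1], by linarith [ht.2]⟩
    · intro t ht
      exact γ.extend_trans_of_le_half δ (ht.2.trans hb2)
  · have h1 := hB' (2 * a - 1) (2 * b - 1) (by linarith) (by linarith) (by linarith)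
      (fun c hcB hcI =>
      hc ((c + 1) / 2) (Finset.mem_union_right _ (Finset.mem_union_right _
        (Finset.mem_image_of_mem (fun t => (t + 1) / 2) hcB)))
        ⟨by linarith [hcI.1], by linarith [hcI.2]⟩)
    have h2 : ContMDiffOn 𝓘(ℝ, ℝ) 𝓘(ℝ, ℝ) ∞ (fun t : ℝ => 2 * t - 1) (Icc a b) :=
      ((contDiff_const.mul contDiff_id).sub contDiff_const).contMDiff.contMDiffOn
    refine (h1.comp h2 ?_).congr ?_
    · intro t ht
      exact ⟨by linarith [ht.1], by linarith [ht.2]⟩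
    · intro t ht
      exact γ.extend_trans_of_half_le δ (ha2.trans ht.1)

/-- The contraction `K(γ,i)(j) = γ(ij)` of a path, as a path from `γ(0)` to `γ(i)`. -/
def contractPath {x y : M} (γ : Path x y) (i : I) : Path x (γ i) where
  toFun j := γ (i * j)
  continuous_toFun := by fun_prop
  source' := by simp
  target' := by simp

theorem contractPath_extend {x y : M} (γ : Path x y) (i : I) {t : ℝ} (ht : t ∈ Icc (0 : ℝ) 1) :
    (contractPath γ i).extend t = γ.extend (i * t) := by
  have h : (i : ℝ) * t ∈ Icc (0 : ℝ) 1 := (i * ⟨t, ht⟩ : I).2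
  rw [Path.extend_apply _ ht, Path.extend_apply _ h]
  rfl

theorem IsPiecewiseSmooth.contractPath {x y : M} {γ : Path x y}
    (h : IsPiecewiseSmooth EM γ) (i : I) : IsPiecewiseSmooth EM (contractPath γ i) := by
  classical
  obtain ⟨B, hB⟩ := h
  rcases eq_or_lt_of_le i.2.1 with h0 | h0
  · refine ⟨∅, fun a b ha _ hb _ => ?_⟩
    refine (contMDiffOn_const (c := γ.extend 0)).congr ?_
    intro t ht
    rw [contractPath_extend γ i ⟨ha.trans ht.1, ht.2.trans hb⟩, ← h0, zero_mul]
  · refine ⟨B.image (fun t => t / i), fun a b ha hab hb hc => ?_⟩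
    have h1 := hB (i * a) (i * b) (by positivity) (by gcongr)
      (by nlinarith [i.2.2]) (fun c hcB hcI =>
      hc (c / i) (Finset.mem_image_of_mem _ hcB)
        ⟨(lt_div_iff₀' h0).2 hcI.1, (div_lt_iff₀' h0).2 hcI.2⟩)
    have h2 : ContMDiffOn 𝓘(ℝ, ℝ) 𝓘(ℝ, ℝ) ∞ (fun t : ℝ => (i : ℝ) * t) (Icc a b) :=
      (contDiff_const.mul contDiff_id).contMDiff.contMDiffOn
    refine (h1.comp h2 ?_).congr ?_
    · intro t ht
      exact ⟨mul_le_mul_of_nonneg_left ht.1 h0.le, mul_le_mul_of_nonneg_left ht.2 h0.le⟩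
    · intro t ht
      exact contractPath_extend γ i ⟨ha.trans ht.1, ht.2.trans hb⟩

variable (EM)

/-- The piecewise smooth paths of `M` from `x` to `y`. -/
structure PwPath (x y : M) where
  toPath : Path x y
  smooth : IsPiecewiseSmooth EM toPath

/-- The space `ΩM` of piecewise smooth loops based at `x₀`. -/
abbrev PwLoopSpace (x₀ : M) := PwPath EM x₀ x₀

/-- The space `PM` of piecewise smooth paths that start at `x₀`, as pairs of the end point `p(1)` and
a path from `x₀` to it. -/
def PwPathSpace (x₀ : M) := Σ y : M, PwPath EM x₀ y

variable {EM} {x₀ : M}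

/-- First `γ`, then `δ`; in the notation for products of paths: `δ ∘ γ`. -/
def PwPath.trans {x y z : M} (γ : PwPath EM x y) (δ : PwPath EM y z) : PwPath EM x z :=
  ⟨γ.toPath.trans δ.toPath, γ.smooth.trans δ.smooth⟩

/-- The reversed path `γ⁻¹`. -/
def PwPath.symm {x y : M} (γ : PwPath EM x y) : PwPath EM y x :=
  ⟨γ.toPath.symm, γ.smooth.symm⟩

/-- A loop is thin if it can be contracted to the constant loop, relative to the base point, inside
its own image. -/
def IsThin (γ : PwLoopSpace EM x₀) : Prop :=
  ∃ F : γ.toPath.Homotopy (Path.refl x₀), range F ⊆ range γ.toPath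

namespace PwPathSpace

/-- The end point `p(1)`. -/
def endpoint (p : PwPathSpace EM x₀) : M := p.1

/-- The point `p(i)`, for `i ∈ [0,1]`. -/
def eval (p : PwPathSpace EM x₀) (i : ℝ) : M := p.2.toPath.extend i

/-- The contraction `K(p,i)`, `K(p,i)(j) = p(ij)`, for `i ∈ [0,1]` (other `i ∈ ℝ` are replaced by the
nearest point of `[0,1]`). -/
def contract (p : PwPathSpace EM x₀) (i : ℝ) : PwPathSpace EM x₀ :=
  ⟨p.eval i, ⟨contractPath p.2.toPath (projIcc 0 1 zero_le_one i), p.2.smooth.contractPath _⟩⟩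

/-- The loop `p⁻¹ ∘ p'`: first along `p'`, then back along `p`, for `p(1) = p'(1)`. -/
def invComp (p p' : PwPathSpace EM x₀) (h : p.endpoint = p'.endpoint) : PwLoopSpace EM x₀ :=
  p'.2.trans ⟨p.2.symm.toPath.cast h.symm rfl, p.2.symm.smooth⟩

/-- A loop as an element of the space of paths. -/
def ofLoop (γ : PwLoopSpace EM x₀) : PwPathSpace EM x₀ := ⟨x₀, γ⟩

/-- A family of paths `ψ`, indexed by an open subset `U` of a manifold `N`, is smooth if its
associated map `(u,i) ↦ ψ[u](i)` is continuous on `U × [0,1]` and there is a finite set `B` of break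
points such that the map is smooth on `U × [a,b]` for each `[a,b] ⊆ [0,1]` that has no break point in
its interior. -/
def IsSmoothFamilyOn (EN : Type*) [NormedAddCommGroup EN] [NormedSpace ℝ EN]
    {N : Type*} [TopologicalSpace N] [ChartedSpace EN N] (U : Set N) (ψ : N → PwPathSpace EM x₀) : Prop :=
  ContinuousOn (fun z : N × ℝ => (ψ z.1).eval z.2) (U ×ˢ Icc (0 : ℝ) 1) ∧
  ∃ B : Finset ℝ, ∀ a b : ℝ, 0 ≤ a → a < b → b ≤ 1 → (∀ c ∈ B, c ∉ Ioo a b) →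
    ContMDiffOn (𝓘(ℝ, EN).prod 𝓘(ℝ, ℝ)) 𝓘(ℝ, EM) ∞
      (fun z : N × ℝ => (ψ z.1).eval z.2) (U ×ˢ Icc a b)

end PwPathSpace

end Paths

section Connection

variable {EP : Type*} [NormedAddCommGroup EP] [NormedSpace ℝ EP]
  {HP : Type*} [TopologicalSpace HP] (IP : ModelWithCorners ℝ EP HP)
  {P : Type*} [TopologicalSpace P] [ChartedSpace HP P] [IsManifold IP ∞ P]
  {EM : Type*} [NormedAddCommGroup EM] [NormedSpace ℝ EM]
  {HM : Type*} [TopologicalSpace HM] (IM : ModelWithCorners ℝ EM HM)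
  {M : Type*} [TopologicalSpace M] [ChartedSpace HM M] {G : Type*}

/-- A smooth connection on a principal bundle with projection `π : P → M` and right action `R`: a
distribution `Γ` on `P` that is complementary to the vertical subspaces `ker π_*`, invariant under
the right action, and smooth, i.e. locally spanned by a frame of smooth vector fields. -/
structure IsSmoothConnection (π : P → M) (R : P → G → P)
    (Γ : (a : P) → Submodule ℝ (TangentSpace IP a)) : Prop where
  isCompl : ∀ a : P, IsCompl (Γ a) (LinearMap.ker (mfderiv IP IM π a).toLinearMap)
  equivariant : ∀ (a : P) (g : G),
    (Γ a).map (mfderiv IP IP (fun b => R b g) a).toLinearMap = Γ (R a g)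
  smooth : ∀ a : P, ∃ V : Set P, IsOpen V ∧ a ∈ V ∧
    ∃ (k : ℕ) (X : Fin k → (b : P) → TangentSpace IP b),
      (∀ μ, ContMDiffOn IP IP.tangent ∞ (fun b => (⟨b, X μ b⟩ : TangentBundle IP P)) V) ∧
      ∀ b ∈ V, LinearIndependent ℝ (fun μ => X μ b) ∧
        Γ b = Submodule.span ℝ (range fun μ => X μ b)

end Connection

section Bundle

variable {EM : Type*} [NormedAddCommGroup EM] [NormedSpace ℝ EM]
  {M : Type*} [TopologicalSpace M] [ChartedSpace EM M] {x₀ : M}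
  {EG : Type*} [NormedAddCommGroup EG] [NormedSpace ℝ EG]
  {G : Type*} [TopologicalSpace G] [ChartedSpace EG G] [Group G]

variable (EG) in
/-- The axioms of a holonomy map `H : ΩM → G`. -/
structure IsHolonomyMap (H : PwLoopSpace EM x₀ → G) : Prop where
  /-- `H(α ∘ β) = H(β) H(α)`, where `α ∘ β` is first `β`, then `α`. -/
  map_comp : ∀ α β : PwLoopSpace EM x₀, H (β.trans α) = H β * H α
  map_thin : ∀ γ : PwLoopSpace EM x₀, IsThin γ → H γ = 1
  smooth : ∀ (n : ℕ) (U : Set (EuclideanSpace ℝ (Fin n))), IsOpen U →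
    ∀ Ω : EuclideanSpace ℝ (Fin n) → PwLoopSpace EM x₀,
      PwPathSpace.IsSmoothFamilyOn (EuclideanSpace ℝ (Fin n)) U
        (fun u => PwPathSpace.ofLoop (Ω u)) →
        ContMDiffOn 𝓘(ℝ, EuclideanSpace ℝ (Fin n)) 𝓘(ℝ, EG) ∞ (fun u => H (Ω u)) U

/-- `(p,g) T (p',g')` iff `p(1) = p'(1)` and `g' = H(p⁻¹ ∘ p') g`. -/
def BundleRel (H : PwLoopSpace EM x₀ → G) (a b : PwPathSpace EM x₀ × G) : Prop :=
  ∃ h : a.1.endpoint = b.1.endpoint, b.2 = H (a.1.invComp b.1 h) * a.2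

/-- The total space `E = (PM × G)/T`. (If `H` is a holonomy map, `T` is an equivalence relation.) -/
def ReconstructedBundle (H : PwLoopSpace EM x₀ → G) := Quot (BundleRel H)

namespace ReconstructedBundle

variable (H : PwLoopSpace EM x₀ → G)

/-- The class `{p,g}` of `(p,g)`. -/
def mk (p : PwPathSpace EM x₀) (g : G) : ReconstructedBundle H := Quot.mk _ (p, g)

variable {H}

/-- The projection `π{p,g} = p(1)`. -/
def proj : ReconstructedBundle H → M :=
  Quot.lift (fun a => a.1.endpoint) (fun _ _ h => h.choose)

/-- The right action `R_g{p,h} = {p,hg}`. -/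
def act (a : ReconstructedBundle H) (g : G) : ReconstructedBundle H :=
  Quot.map (fun b => (b.1, b.2 * g))
    (fun b c ⟨h, hc⟩ => ⟨h, by rw [hc, mul_assoc]⟩) a

variable (H) in
/-- The local trivialization `C_ψ(u,g) = {ψ[u],g}`, for a family of paths `ψ`. -/
def triv (ψ : M → PwPathSpace EM x₀) (z : M × G) : ReconstructedBundle H := mk H (ψ z.1) z.2

variable (EG H) in
/-- The charts of `E` make up the differential structure that is given by the local trivializations:
for each contractible open `U ⊆ M` and each smooth family `ψ` of paths over `U` with `ψ[u](1) = u`,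
the map `C_ψ` is a diffeomorphism from `U × G` onto the open set `π⁻¹(U)`. -/
def HasReconstructedCharts [TopologicalSpace (ReconstructedBundle H)]
    [ChartedSpace (ModelProd EM EG) (ReconstructedBundle H)] : Prop :=
  ∀ (U : Set M), IsOpen U → ContractibleSpace U →
    ∀ ψ : M → PwPathSpace EM x₀, PwPathSpace.IsSmoothFamilyOn EM U ψ → (∀ u ∈ U, (ψ u).endpoint = u) →
      ∃ Φ : PartialDiffeomorph (𝓘(ℝ, EM).prod 𝓘(ℝ, EG)) (𝓘(ℝ, EM).prod 𝓘(ℝ, EG))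
          (M × G) (ReconstructedBundle H) ∞,
        Φ.source = U ×ˢ univ ∧ Φ.target = proj ⁻¹' U ∧ EqOn Φ.toFun (triv H ψ) (U ×ˢ univ)

variable (EG) in
/-- The distribution `Γ`: at `a = {p,g}` it is spanned by the velocities at `i = j` of the curves
`[0,1] ∋ i ↦ {K(r,i), h}` with `h = H(p⁻¹ ∘ K(r,j)) g`, where `r ∈ PM` and `j ∈ [0,1]` satisfy
`r(j) = p(1)`, so that the curve is at `a` for `i = j`. All those velocities are taken that exist
(one-sided ones at the ends of `[0,1]`). -/
def Γ [TopologicalSpace (ReconstructedBundle H)] [ChartedSpace (ModelProd EM EG) (ReconstructedBundle H)]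
    (a : ReconstructedBundle H) : Submodule ℝ (TangentSpace (𝓘(ℝ, EM).prod 𝓘(ℝ, EG)) a) :=
  Submodule.span ℝ
    {v | ∃ (p : PwPathSpace EM x₀) (g : G) (r : PwPathSpace EM x₀) (j : ℝ)
        (hj : p.endpoint = (r.contract j).endpoint),
      a = mk H p g ∧ j ∈ Icc (0 : ℝ) 1 ∧
      HasMFDerivWithinAt 𝓘(ℝ, ℝ) (𝓘(ℝ, EM).prod 𝓘(ℝ, EG))
        (fun i : ℝ => mk H (r.contract i) (H (p.invComp (r.contract j) hj) * g)) (Icc 0 1) j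
        (ContinuousLinearMap.toSpanSingleton ℝ (M₁ := EM × EG) v)}

end ReconstructedBundle

end Bundle

end HolonomyReconstruction

end

open HolonomyReconstruction

/-!
The transition function between two trivializations `C_ψ` and `C_ψ'` is left multiplication by
`H (ψ[u]⁻¹ ∘ ψ'[u])`, which by (3) depends smoothly on `u`. Hence the `C_ψ` are smooth
parametrizations of `E`, and they determine its manifold structure, the action and the projection.

The curve `{K(r, i), h}` is the parallel transport of `{K(r, j), h}` along `r`. It does not depend
on the way `r` is parametrized between `j` and `i`, because a loop that factors through an interval
is thin, and it does not depend on how `{K(r, j), h}` is represented. Transport along straight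
segments in a chart of `M` is jointly smooth in the starting point and in the segment, again by (3).
Its derivative is a linear right inverse of `π_*` that varies smoothly with the starting point and
commutes with the action, so its range is a connection.

It remains to see that each velocity vector in question is the horizontal lift of the velocity of
`r`. As `r` is smooth only on either side of `j`, `r (j ± t)` is composed with the even function
`t = s² / (1 + s²)`; in a chart it becomes `y + s² • C s` with `C` smooth on the whole line. The
transport `T (τ, s)` along `t ↦ y + τ t² • C (s t)` is smooth in `(τ, s)`. It is a transport along
segments for `s = 0`, it is constant for `τ = 0`, and it is the given curve for `τ = s²`. So the
one-sided derivative of the curve at `j` equals `∂T/∂τ (0, 0)`, the horizontal lift of `C 0`.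
-/

namespace HolonomyReconstruction

section ThinLoops

variable {EM : Type*} [NormedAddCommGroup EM] [NormedSpace ℝ EM]
  {M : Type*} [TopologicalSpace M] [ChartedSpace EM M] {x₀ : M}

theorem PwPath.symm_symm {x y : M} (a : PwPath EM x y) : a.symm.symm = a := by
  simp only [PwPath.symm, Path.symm_symm]

theorem PwPath.symm_trans {x y z : M} (a : PwPath EM x y) (b : PwPath EM y z) :
    (a.trans b).symm = b.symm.trans a.symm := by
  simp only [PwPath.symm, PwPath.trans, Path.trans_symm]

theorem isThin_of_homotopic_refl {X : Type*} [TopologicalSpace X] {x : X} {L : Path x x}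
    (hL : L.Homotopic (Path.refl x)) {f : X → M} (hf : Continuous f)
    {γ : PwLoopSpace EM x₀} (hγ : ∀ t, γ.toPath t = f (L t)) (hr : range f ⊆ range γ.toPath) :
    IsThin γ := by
  obtain ⟨F⟩ := hL
  obtain rfl : f x = x₀ := by simpa using (hγ 0).symm
  refine ⟨(F.map ⟨f, hf⟩).cast (by ext t; exact (hγ t).symm) (by ext t; rfl), ?_⟩
  rintro _ ⟨z, rfl⟩
  exact hr ⟨F z, rfl⟩

/-- A path, as a path in a subspace that contains it. -/
def pathCodRestrict {X : Type*} [TopologicalSpace X] {x y : X} (p : Path x y) (R : Set X)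
    (h : range p ⊆ R) : Path (⟨x, h ⟨0, p.source⟩⟩ : R) ⟨y, h ⟨1, p.target⟩⟩ where
  toFun t := ⟨p t, h ⟨t, rfl⟩⟩
  continuous_toFun := by fun_prop
  source' := by simp
  target' := by simp

theorem isThin_of_eq_comp_real {a : ℝ} (L : Path a a) {f : ℝ → M} (hf : Continuous f)
    {γ : PwLoopSpace EM x₀} (hγ : ∀ t, γ.toPath t = f (L t)) : IsThin γ := by
  have : ContractibleSpace (range L) :=
    (isPreconnected_range L.continuous).ordConnected.convex.contractibleSpace ⟨a, 0, L.source⟩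
  refine isThin_of_homotopic_refl (L := pathCodRestrict L (range L) subset_rfl)
    (SimplyConnectedSpace.paths_homotopic _ _) (hf.comp continuous_subtype_val) hγ ?_
  rintro _ ⟨⟨_, t, rfl⟩, rfl⟩
  exact ⟨t, hγ t⟩

variable {EG : Type*} [NormedAddCommGroup EG] [NormedSpace ℝ EG]
  {G : Type*} [TopologicalSpace G] [ChartedSpace EG G] [Group G] {H : PwLoopSpace EM x₀ → G}

namespace IsHolonomyMap

theorem map_trans_symm_of_eq_comp_real (hH : IsHolonomyMap EG H) {y : M} {a b : PwPath EM x₀ y}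
    {s t : ℝ} (A B : Path s t) {f : ℝ → M} (hf : Continuous f)
    (ha : ∀ i, a.toPath i = f (A i)) (hb : ∀ i, b.toPath i = f (B i)) :
    H (b.trans a.symm) = 1 := by
  refine hH.map_thin _ (isThin_of_eq_comp_real (B.trans A.symm) hf fun i => ?_)
  simp only [PwPath.trans, PwPath.symm, Path.trans_apply, Path.symm_apply, Function.comp_apply, ha,
    hb, apply_dite f]

theorem map_trans_symm_self (hH : IsHolonomyMap EG H) {y : M} (a : PwPath EM x₀ y) :
    H (a.trans a.symm) = 1 := by
  have h (i : I) : a.toPath i = a.toPath.extend (Path.segment (0 : ℝ) 1 i) := by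
    simp [AffineMap.lineMap_apply]
  exact hH.map_trans_symm_of_eq_comp_real _ _ a.toPath.continuous_extend h h

theorem map_eq_of_homotopic (hH : IsHolonomyMap EG H) {X : Type*} [TopologicalSpace X] {x : X}
    {P Q : Path x x} (hPQ : P.Homotopic Q) {f : X → M} (hf : Continuous f)
    {γ δ : PwLoopSpace EM x₀} (hγ : ∀ t, γ.toPath t = f (P t)) (hδ : ∀ t, δ.toPath t = f (Q t))
    (hr : range f ⊆ range γ.toPath ∪ range δ.toPath) : H γ = H δ := by
  have hnull : (P.trans Q.symm).Homotopic (Path.refl x) := by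
    rw [← Path.Homotopic.Quotient.eq] at hPQ ⊢
    simp [hPQ]
  have htrans : H (PwPath.trans γ δ.symm) = 1 := by
    refine hH.map_thin _ (isThin_of_homotopic_refl hnull hf (fun t => ?_) ?_)
    · simp only [PwPath.trans, PwPath.symm, Path.trans_apply, Path.symm_apply, Function.comp_apply,
        hγ, hδ, apply_dite f]
    · rwa [PwPath.trans, PwPath.symm, Path.trans_range, Path.symm_range]
  have hself := hH.map_trans_symm_self δ
  rw [hH.map_comp] at htrans hself
  exact mul_right_cancel (htrans.trans hself.symm)

theorem map_trans_cancel (hH : IsHolonomyMap EG H) {y z : M} (a : PwPath EM x₀ y)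
    (q : PwPath EM y z) (b : PwPath EM y x₀) :
    H ((a.trans q).trans (q.symm.trans b)) = H (a.trans b) := by
  set R : Set M := range a.toPath ∪ range q.toPath ∪ range b.toPath with hR
  let A := pathCodRestrict a.toPath R fun _ h => Or.inl (Or.inl h)
  let Q := pathCodRestrict q.toPath R fun _ h => Or.inl (Or.inr h)
  let B := pathCodRestrict b.toPath R fun _ h => Or.inr h
  have hAB : ((A.trans Q).trans (Q.symm.trans B)).Homotopic (A.trans B) := by
    rw [← Path.Homotopic.Quotient.eq]
    simp only [Path.Homotopic.Quotient.mk_trans, Path.Homotopic.Quotient.mk_symm]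
    rw [Path.Homotopic.Quotient.trans_assoc,
      ← Path.Homotopic.Quotient.trans_assoc (Path.Homotopic.Quotient.mk Q)]
    simp
  refine hH.map_eq_of_homotopic hAB continuous_subtype_val (fun t => ?_) (fun t => ?_) ?_
  · simp only [PwPath.trans, PwPath.symm, Path.trans_apply, Path.symm_apply, apply_dite Subtype.val]
    rfl
  · simp only [PwPath.trans, Path.trans_apply, apply_dite Subtype.val]
    rfl
  · simp only [PwPath.trans, PwPath.symm, Path.trans_range, Path.symm_range, Subtype.range_coe, hR]
    intro z hz
    simp only [mem_union] at hz ⊢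
    tauto

theorem map_trans_symm_mul (hH : IsHolonomyMap EG H) {y : M} (a b c : PwPath EM x₀ y) :
    H (c.trans b.symm) * H (b.trans a.symm) = H (c.trans a.symm) := by
  simpa only [← hH.map_comp, PwPath.symm_symm] using hH.map_trans_cancel c b.symm a.symm

theorem map_trans_trans_symm (hH : IsHolonomyMap EG H) {y z : M} (a b : PwPath EM x₀ y)
    (q : PwPath EM y z) : H ((b.trans q).trans (a.trans q).symm) = H (b.trans a.symm) := by
  rw [PwPath.symm_trans, hH.map_trans_cancel]

theorem map_invComp_self (hH : IsHolonomyMap EG H) (p : PwPathSpace EM x₀) :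
    H (p.invComp p rfl) = 1 :=
  hH.map_trans_symm_self p.2

theorem map_invComp_mul (hH : IsHolonomyMap EG H) (p p' p'' : PwPathSpace EM x₀)
    (h : p.endpoint = p'.endpoint) (h' : p'.endpoint = p''.endpoint) :
    H (p'.invComp p'' h') * H (p.invComp p' h) = H (p.invComp p'' (h.trans h')) := by
  obtain ⟨y, a⟩ := p
  obtain ⟨y', b⟩ := p'
  obtain ⟨y'', c⟩ := p''
  obtain rfl : y = y' := h
  obtain rfl : y = y'' := h'
  exact hH.map_trans_symm_mul a b c

theorem equivalence_bundleRel (hH : IsHolonomyMap EG H) : Equivalence (BundleRel H) where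
  refl a := ⟨rfl, by rw [hH.map_invComp_self, one_mul]⟩
  symm := by
    rintro a b ⟨h, hg⟩
    exact ⟨h.symm, by rw [hg, ← mul_assoc, hH.map_invComp_mul, hH.map_invComp_self, one_mul]⟩
  trans := by
    rintro a b c ⟨h, hg⟩ ⟨h', hg'⟩
    exact ⟨h.trans h', by rw [hg', hg, ← mul_assoc, hH.map_invComp_mul]⟩

end IsHolonomyMap

end ThinLoops

section Classes

variable {EM : Type*} [NormedAddCommGroup EM] [NormedSpace ℝ EM]
  {M : Type*} [TopologicalSpace M] [ChartedSpace EM M] {x₀ : M}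
  {G : Type*} [Group G] {H : PwLoopSpace EM x₀ → G}

namespace ReconstructedBundle

theorem exists_eq_mk (a : ReconstructedBundle H) (p : PwPathSpace EM x₀)
    (h : p.endpoint = a.proj) : ∃ g, a = mk H p g := by
  induction a using Quot.ind with
  | mk b => exact ⟨H (b.1.invComp p h.symm) * b.2, Quot.sound ⟨h.symm, rfl⟩⟩

@[simp]
theorem proj_act (a : ReconstructedBundle H) (g : G) : (a.act g).proj = a.proj := by
  induction a using Quot.ind with
  | mk b => rfl

variable {EG : Type*} [NormedAddCommGroup EG] [NormedSpace ℝ EG]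
  [TopologicalSpace G] [ChartedSpace EG G]

theorem mk_eq_mk_iff (hH : IsHolonomyMap EG H) {p p' : PwPathSpace EM x₀} {g g' : G} :
    mk H p g = mk H p' g' ↔ ∃ h : p.endpoint = p'.endpoint, g' = H (p.invComp p' h) * g :=
  hH.equivalence_bundleRel.quot_mk_eq_iff _ _

theorem mk_injective (hH : IsHolonomyMap EG H) (p : PwPathSpace EM x₀) :
    Function.Injective (mk H p) := by
  intro g g' h
  obtain ⟨_, h⟩ := (mk_eq_mk_iff hH).1 h
  rw [h, hH.map_invComp_self, one_mul]

theorem mk_eq_mk_of_eq_comp_real (hH : IsHolonomyMap EG H) {p p' : PwPathSpace EM x₀} {s t : ℝ}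
    (A B : Path s t) {f : ℝ → M} (hf : Continuous f)
    (hp : ∀ i : I, p.eval i = f (A i)) (hp' : ∀ i : I, p'.eval i = f (B i)) (g : G) :
    mk H p g = mk H p' g := by
  obtain ⟨y, a⟩ := p
  obtain ⟨y', b⟩ := p'
  simp only [PwPathSpace.eval, Path.extend_extends'] at hp hp'
  obtain rfl : y = y' := by
    rw [← a.toPath.target, ← b.toPath.target, hp, hp', A.target, B.target]
  have hone : H (PwPathSpace.invComp ⟨y, a⟩ ⟨y, b⟩ rfl) = 1 :=
    hH.map_trans_symm_of_eq_comp_real A B hf hp hp'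
  exact (mk_eq_mk_iff hH).2 ⟨rfl, by rw [hone, one_mul]⟩

end ReconstructedBundle

end Classes

section PwSmooth

variable (EM : Type*) [NormedAddCommGroup EM] [NormedSpace ℝ EM]
  {M : Type*} [TopologicalSpace M] [ChartedSpace EM M]
  {EN : Type*} [NormedAddCommGroup EN] [NormedSpace ℝ EN]
  {HN : Type*} [TopologicalSpace HN] (IN : ModelWithCorners ℝ EN HN)
  {N : Type*} [TopologicalSpace N] [ChartedSpace HN N]
  {EK : Type*} [NormedAddCommGroup EK] [NormedSpace ℝ EK]
  {HK : Type*} [TopologicalSpace HK] {IK : ModelWithCorners ℝ EK HK}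
  {K : Type*} [TopologicalSpace K] [ChartedSpace HK K]

theorem continuousOn_prod_union {X Y Z : Type*} [TopologicalSpace X] [TopologicalSpace Y]
    [TopologicalSpace Z] {f : X × Y → Z} {A : Set X} {s t : Set Y} (hs : IsClosed s)
    (ht : IsClosed t) (hfs : ContinuousOn f (A ×ˢ s)) (hft : ContinuousOn f (A ×ˢ t)) :
    ContinuousOn f (A ×ˢ (s ∪ t)) := by
  intro z hz
  have within {r : Set Y} (hr : IsClosed r) (hfr : ContinuousOn f (A ×ˢ r)) :
      ContinuousWithinAt f (A ×ˢ r) z := by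
    by_cases hzr : z.2 ∈ r
    · exact hfr z ⟨hz.1, hzr⟩
    · exact continuousWithinAt_of_notMem_closure fun hcl =>
        hzr (closure_minimal (fun _ h => h.2) (hr.preimage continuous_snd) hcl)
  rw [prod_union]
  exact (within hs hfs).union (within ht hft)

/-- Smooth families of curves over `S ⊆ ℝ`, with common break points. Unlike in
`PwPathSpace.IsSmoothFamilyOn`, the parameters range over a subset `V` of a manifold with an
arbitrary model, such as a product. -/
def PwSmoothOn (V : Set N) (S : Set ℝ) (F : N × ℝ → M) : Prop :=
  ContinuousOn F (V ×ˢ S) ∧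
  ∃ B : Finset ℝ, ∀ a b : ℝ, a < b → Icc a b ⊆ S → (∀ c ∈ B, c ∉ Ioo a b) →
    ContMDiffOn (IN.prod 𝓘(ℝ, ℝ)) 𝓘(ℝ, EM) ∞ F (V ×ˢ Icc a b)

namespace PwSmoothOn

variable {EM IN} {V : Set N} {S : Set ℝ} {F : N × ℝ → M}

theorem of_contMDiffOn (h : ContMDiffOn (IN.prod 𝓘(ℝ, ℝ)) 𝓘(ℝ, EM) ∞ F (V ×ˢ S)) :
    PwSmoothOn EM IN V S F :=
  ⟨h.continuousOn, ∅, fun _ _ _ hS _ => h.mono (prod_mono_right hS)⟩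

theorem comp (h : PwSmoothOn EM IN V S F) {V' : Set K} {θ : K → N}
    (hθ : ContMDiffOn IK IN ∞ θ V') (hV : MapsTo θ V' V) :
    PwSmoothOn EM IK V' S (fun z => F (θ z.1, z.2)) := by
  obtain ⟨hc, B, hB⟩ := h
  have hθ' (s : Set ℝ) : ContMDiffOn (IK.prod 𝓘(ℝ, ℝ)) (IN.prod 𝓘(ℝ, ℝ)) ∞
      (fun z : K × ℝ => (θ z.1, z.2)) (V' ×ˢ s) :=
    (hθ.comp contMDiffOn_fst fun z hz => hz.1).prodMk contMDiffOn_snd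
  exact ⟨hc.comp (hθ' _).continuousOn fun z hz => ⟨hV hz.1, hz.2⟩, B, fun a b hab hS hcB =>
    (hB a b hab hS hcB).comp (hθ' _) fun z hz => ⟨hV hz.1, hz.2⟩⟩

theorem congr (h : PwSmoothOn EM IN V S F) {F' : N × ℝ → M} (hF : EqOn F' F (V ×ˢ S)) :
    PwSmoothOn EM IN V S F' := by
  obtain ⟨hc, B, hB⟩ := h
  exact ⟨hc.congr hF, B, fun a b hab hS hcB =>
    (hB a b hab hS hcB).congr (hF.mono (prod_mono_right hS))⟩

theorem comp_injective (h : PwSmoothOn EM IN V S F) {T : Set ℝ} {φ : ℝ → ℝ}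
    (hφ : ContDiff ℝ ∞ φ) (hinj : Function.Injective φ) (hT : MapsTo φ T S) :
    PwSmoothOn EM IN V T (fun z => F (z.1, φ z.2)) := by
  obtain ⟨hc, B, hB⟩ := h
  have hφ' : ContMDiff (IN.prod 𝓘(ℝ, ℝ)) (IN.prod 𝓘(ℝ, ℝ)) ∞ (fun z : N × ℝ => (z.1, φ z.2)) :=
    contMDiff_fst.prodMk (hφ.contMDiff.comp contMDiff_snd)
  refine ⟨hc.comp hφ'.continuous.continuousOn fun z hz => ⟨hz.1, hT hz.2⟩,
    B.preimage φ hinj.injOn, fun a b hab hS hcB => ?_⟩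
  obtain ⟨a', b', hab', hmaps, hIcc, hIoo⟩ : ∃ a' b', a' < b' ∧ MapsTo φ (Icc a b) (Icc a' b') ∧
      Icc a' b' ⊆ φ '' Icc a b ∧ Ioo a' b' ⊆ φ '' Ioo a b := by
    have hcont := hφ.continuous.continuousOn (s := Icc a b)
    rcases hφ.continuous.strictMono_of_inj hinj with hm | hm
    · exact ⟨φ a, φ b, hm hab, hm.monotone.mapsTo_Icc, intermediate_value_Icc hab.le hcont,
        intermediate_value_Ioo hab.le hcont⟩
    · exact ⟨φ b, φ a, hm hab, hm.antitone.mapsTo_Icc, intermediate_value_Icc' hab.le hcont,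
        intermediate_value_Ioo' hab.le hcont⟩
  refine (hB a' b' hab' (hIcc.trans (hT.mono_left hS).image_subset) fun c hc hcI => ?_).comp
    hφ'.contMDiffOn fun z hz => ⟨hz.1, hmaps hz.2⟩
  obtain ⟨d, hd, rfl⟩ := hIoo hcI
  exact hcB d (Finset.mem_preimage.2 hc) hd

theorem union {a b c : ℝ} (h : PwSmoothOn EM IN V (Icc a b) F)
    (h' : PwSmoothOn EM IN V (Icc b c) F) (hab : a ≤ b) (hbc : b ≤ c) :
    PwSmoothOn EM IN V (Icc a c) F := by
  classical
  obtain ⟨hc, B, hB⟩ := h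
  obtain ⟨hc', B', hB'⟩ := h'
  refine ⟨?_, {b} ∪ (B ∪ B'), fun x y hxy hS hcB => ?_⟩
  · rw [← Icc_union_Icc_eq_Icc hab hbc]
    exact continuousOn_prod_union isClosed_Icc isClosed_Icc hc hc'
  have hac := (Icc_subset_Icc_iff hxy.le).1 hS
  simp only [Finset.mem_union, Finset.mem_singleton, or_imp, forall_and, forall_eq] at hcB
  obtain ⟨hb, hcB, hcB'⟩ := hcB
  rcases le_or_gt y b with hyb | hby
  · exact hB x y hxy (Icc_subset_Icc hac.1 hyb) hcB
  · exact hB' x y hxy (Icc_subset_Icc (not_lt.1 fun hxb => hb ⟨hxb, hby⟩) hac.2) hcB'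

theorem symm (h : PwSmoothOn EM IN V (Icc 0 1) F) :
    PwSmoothOn EM IN V (Icc 0 1) (fun z => F (z.1, 1 - z.2)) :=
  h.comp_injective (contDiff_const.sub contDiff_id) sub_right_injective fun _ ht =>
    ⟨sub_nonneg.2 ht.2, sub_le_self _ ht.1⟩

theorem trans {F₁ F₂ : N × ℝ → M} (h₁ : PwSmoothOn EM IN V (Icc 0 1) F₁)
    (h₂ : PwSmoothOn EM IN V (Icc 0 1) F₂)
    (hF₁ : ∀ u ∈ V, ∀ t ∈ Icc (0 : ℝ) (1 / 2), F (u, t) = F₁ (u, 2 * t))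
    (hF₂ : ∀ u ∈ V, ∀ t ∈ Icc (1 / 2 : ℝ) 1, F (u, t) = F₂ (u, 2 * t - 1)) :
    PwSmoothOn EM IN V (Icc 0 1) F := by
  have hinj : Function.Injective fun t : ℝ => 2 * t := mul_right_injective₀ two_ne_zero
  refine union (b := 1 / 2) ?_ ?_ (by norm_num) (by norm_num)
  · refine (h₁.comp_injective (φ := fun t => 2 * t) (by fun_prop) hinj fun t ht =>
      ⟨by linarith [ht.1], by linarith [ht.2]⟩).congr fun z hz => hF₁ z.1 hz.1 z.2 hz.2
  · refine (h₂.comp_injective (φ := fun t => 2 * t - 1) (by fun_prop)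
      ((sub_left_injective (b := (1 : ℝ))).comp hinj) fun t ht =>
        ⟨by linarith [ht.1], by linarith [ht.2]⟩).congr fun z hz => hF₂ z.1 hz.1 z.2 hz.2

end PwSmoothOn

theorem eventually_forall_notMem_uIoo (B : Finset ℝ) (j : ℝ) :
    ∀ᶠ k in 𝓝 j, ∀ c ∈ B, c ∉ uIoo j k := by
  rw [Finset.eventually_all]
  intro c _
  rcases eq_or_ne c j with rfl | hc
  · exact Filter.Eventually.of_forall fun k => left_notMem_uIoo
  · filter_upwards [Metric.ball_mem_nhds j (dist_pos.2 hc)] with k hk hck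
    rw [Metric.mem_ball, Real.dist_eq, Real.dist_eq] at hk
    exact (abs_sub_left_of_mem_uIcc (uIoo_subset_uIcc_self hck)).not_gt hk

theorem nhdsWithin_diff_singleton_neBot {S : Set ℝ} (hS : S.OrdConnected) (hS' : S.Nontrivial)
    {j : ℝ} (hj : j ∈ S) : (𝓝[S \ {j}] j).NeBot := by
  have := hS.isPreconnected.preperfect_of_nontrivial hS' j hj
  rwa [accPt_principal_iff_nhdsWithin] at this

variable {EM IN} {V : Set N} {S : Set ℝ} {F : N × ℝ → M}

theorem PwSmoothOn.eventually_contMDiffOn (h : PwSmoothOn EM IN V S F) (hS : S.OrdConnected) {j : ℝ}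
    (hj : j ∈ S) : ∀ᶠ k in 𝓝[S \ {j}] j,
      ContMDiffOn (IN.prod 𝓘(ℝ, ℝ)) 𝓘(ℝ, EM) ∞ F (V ×ˢ uIcc j k) := by
  obtain ⟨-, B, hB⟩ := h
  filter_upwards [mem_nhdsWithin_of_mem_nhds (eventually_forall_notMem_uIoo B j),
    self_mem_nhdsWithin] with k hk hkS
  exact hB _ _ (inf_lt_sup.2 (Ne.symm hkS.2)) (hS.uIcc_subset hj hkS.1) hk

theorem PwSmoothOn.contMDiffOn_section (h : PwSmoothOn EM IN V S F) (hS : S.OrdConnected)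
    (hS' : S.Nontrivial) {j : ℝ} (hj : j ∈ S) :
    ContMDiffOn IN 𝓘(ℝ, EM) ∞ (fun u => F (u, j)) V := by
  have := nhdsWithin_diff_singleton_neBot hS hS' hj
  obtain ⟨k, hk⟩ := (h.eventually_contMDiffOn hS hj).exists
  exact hk.comp (contMDiff_id.prodMk contMDiff_const).contMDiffOn fun u hu => ⟨hu, left_mem_uIcc⟩

end PwSmooth

section Glue

variable {EM : Type*} [NormedAddCommGroup EM] [NormedSpace ℝ EM]
  {M : Type*} [TopologicalSpace M] [ChartedSpace EM M] {x₀ : M}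

/-- The constant path. -/
def PwPath.refl (x : M) : PwPath EM x x := ⟨Path.refl x, ∅, fun _ _ _ _ _ _ => contMDiffOn_const⟩

/-- A smooth curve over `[0,1]`, as a path. -/
def PwPath.ofSmooth {f : ℝ → M} (hf : ContMDiffOn 𝓘(ℝ, ℝ) 𝓘(ℝ, EM) ∞ f (Icc 0 1)) {y : M}
    (hy : f 0 = y) : PwPath EM y (f 1) where
  toPath :=
    { toFun := fun t => f t
      continuous_toFun := hf.continuousOn.comp_continuous continuous_subtype_val fun t => t.2
      source' := by simpa using hy
      target' := by simp }
  smooth := ⟨∅, fun a b ha _ hb _ => (hf.mono (Icc_subset_Icc ha hb)).congr fun t ht =>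
    Path.extend_apply _ ⟨ha.trans ht.1, ht.2.trans hb⟩⟩

namespace PwPathSpace

/-- A curve that is smooth over `[0,1]` and can be attached to the path `p`. -/
def Attachable (p : PwPathSpace EM x₀) (f : ℝ → M) : Prop :=
  ContMDiffOn 𝓘(ℝ, ℝ) 𝓘(ℝ, EM) ∞ f (Icc 0 1) ∧ f 0 = p.endpoint

open Classical in
/-- First the path `p`, then the smooth curve `f` over `[0,1]`; just `p` if `f` cannot be attached
to `p`. -/
noncomputable def glue (p : PwPathSpace EM x₀) (f : ℝ → M) : PwPathSpace EM x₀ :=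
  if h : p.Attachable f then ⟨f 1, p.2.trans (PwPath.ofSmooth h.1 h.2)⟩ else p

open Classical in
/-- The loop `p⁻¹ ∘ p'`; a constant loop if `p` and `p'` end at different points. -/
noncomputable def loop (p p' : PwPathSpace EM x₀) : PwLoopSpace EM x₀ :=
  if h : p.endpoint = p'.endpoint then p.invComp p' h else PwPath.refl x₀

theorem eval_one (p : PwPathSpace EM x₀) : p.eval 1 = p.endpoint := p.2.toPath.extend_one

theorem continuous_eval (p : PwPathSpace EM x₀) : Continuous p.eval := p.2.toPath.continuous_extend

theorem eval_contract (p : PwPathSpace EM x₀) {i t : ℝ} (hi : i ∈ Icc (0 : ℝ) 1)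
    (ht : t ∈ Icc (0 : ℝ) 1) : (p.contract i).eval t = p.eval (i * t) := by
  refine (contractPath_extend _ _ ht).trans ?_
  rw [projIcc_of_mem _ hi]
  rfl

theorem glue_eq {p : PwPathSpace EM x₀} {f : ℝ → M} (h : p.Attachable f) :
    p.glue f = ⟨f 1, p.2.trans (PwPath.ofSmooth h.1 h.2)⟩ := dif_pos h

theorem endpoint_glue {p : PwPathSpace EM x₀} {f : ℝ → M} (h : p.Attachable f) :
    (p.glue f).endpoint = f 1 := by rw [glue_eq h]; rfl

theorem eval_glue_left {p : PwPathSpace EM x₀} {f : ℝ → M} (h : p.Attachable f) {t : ℝ}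
    (ht : t ≤ 1 / 2) : (p.glue f).eval t = p.eval (2 * t) := by
  rw [glue_eq h]
  exact Path.extend_trans_of_le_half _ _ ht

theorem eval_glue_right {p : PwPathSpace EM x₀} {f : ℝ → M} (h : p.Attachable f) {t : ℝ}
    (ht : t ∈ Icc (1 / 2 : ℝ) 1) : (p.glue f).eval t = f (2 * t - 1) := by
  rw [glue_eq h]
  refine (Path.extend_trans_of_half_le _ _ ht.1).trans ?_
  exact Path.extend_apply _ ⟨by linarith [ht.1], by linarith [ht.2]⟩

theorem loop_eq {p p' : PwPathSpace EM x₀} (h : p.endpoint = p'.endpoint) :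
    p.loop p' = p.invComp p' h := dif_pos h

theorem eval_ofLoop_loop_left {p p' : PwPathSpace EM x₀} (h : p.endpoint = p'.endpoint) {t : ℝ}
    (ht : t ≤ 1 / 2) : (ofLoop (p.loop p')).eval t = p'.eval (2 * t) := by
  rw [loop_eq h]
  exact Path.extend_trans_of_le_half _ _ ht

theorem eval_ofLoop_loop_right {p p' : PwPathSpace EM x₀} (h : p.endpoint = p'.endpoint) {t : ℝ}
    (ht : 1 / 2 ≤ t) : (ofLoop (p.loop p')).eval t = p.eval (1 - (2 * t - 1)) := by
  rw [loop_eq h]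
  obtain ⟨y, a⟩ := p
  obtain ⟨y', b⟩ := p'
  obtain rfl : y = y' := h
  refine (Path.extend_trans_of_half_le _ _ ht).trans ?_
  exact Path.extend_symm_apply _ _

end PwPathSpace

end Glue

section SmoothFamilies

variable {EM : Type*} [NormedAddCommGroup EM] [NormedSpace ℝ EM]
  {M : Type*} [TopologicalSpace M] [ChartedSpace EM M] {x₀ : M}
  {EN : Type*} [NormedAddCommGroup EN] [NormedSpace ℝ EN]
  {HN : Type*} [TopologicalSpace HN] {IN : ModelWithCorners ℝ EN HN}
  {N : Type*} [TopologicalSpace N] [ChartedSpace HN N]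

namespace PwPathSpace

variable (IN) in
/-- A smooth family of paths, for parameters in a subset of a manifold with an arbitrary model. -/
def IsSmoothFamily (V : Set N) (ψ : N → PwPathSpace EM x₀) : Prop :=
  PwSmoothOn EM IN V (Icc 0 1) (fun z => (ψ z.1).eval z.2)

theorem isSmoothFamily_iff_isSmoothFamilyOn {N : Type*} [TopologicalSpace N] [ChartedSpace EN N]
    {V : Set N} {ψ : N → PwPathSpace EM x₀} :
    IsSmoothFamily 𝓘(ℝ, EN) V ψ ↔ IsSmoothFamilyOn EN V ψ := by
  refine and_congr_right fun _ => exists_congr fun B => forall₂_congr fun a b => ?_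
  refine ⟨fun h ha hab hb => h hab (Icc_subset_Icc ha hb), fun h hab hS => ?_⟩
  have hab' := (Icc_subset_Icc_iff hab.le).1 hS
  exact h hab'.1 hab hab'.2

theorem isSmoothFamily_const (V : Set N) (p : PwPathSpace EM x₀) :
    IsSmoothFamily IN V (fun _ => p) := by
  obtain ⟨B, hB⟩ := p.2.smooth
  refine ⟨p.continuous_eval.comp_continuousOn continuousOn_snd, B, fun a b hab hS hc => ?_⟩
  have hab' := (Icc_subset_Icc_iff hab.le).1 hS
  exact (hB a b hab'.1 hab hab'.2 hc).comp contMDiffOn_snd fun z hz => hz.2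

variable {V : Set N} {ψ : N → PwPathSpace EM x₀}

theorem IsSmoothFamily.endpoint (h : IsSmoothFamily IN V ψ) :
    ContMDiffOn IN 𝓘(ℝ, EM) ∞ (fun u => (ψ u).endpoint) V := by
  simpa only [eval_one] using
    PwSmoothOn.contMDiffOn_section h ordConnected_Icc ⟨0, by simp, 1, by simp, zero_ne_one⟩
      (right_mem_Icc.2 zero_le_one)

theorem IsSmoothFamily.comp (h : IsSmoothFamily IN V ψ) {EK : Type*} [NormedAddCommGroup EK]
    [NormedSpace ℝ EK] {HK : Type*} [TopologicalSpace HK] {IK : ModelWithCorners ℝ EK HK}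
    {K : Type*} [TopologicalSpace K] [ChartedSpace HK K] {W : Set K} {θ : K → N}
    (hθ : ContMDiffOn IK IN ∞ θ W) (hW : MapsTo θ W V) : IsSmoothFamily IK W fun k => ψ (θ k) :=
  PwSmoothOn.comp h hθ hW

theorem IsSmoothFamily.mono (h : IsSmoothFamily IN V ψ) {W : Set N} (hW : W ⊆ V) :
    IsSmoothFamily IN W ψ :=
  h.comp contMDiffOn_id hW

theorem attachable_of_contMDiffOn {f : N → ℝ → M}
    (hf : ContMDiffOn (IN.prod 𝓘(ℝ, ℝ)) 𝓘(ℝ, EM) ∞ (fun z : N × ℝ => f z.1 z.2)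
      (V ×ˢ Icc (0 : ℝ) 1)) (hf0 : ∀ u ∈ V, f u 0 = (ψ u).endpoint) {u : N} (hu : u ∈ V) :
    (ψ u).Attachable (f u) :=
  ⟨hf.comp (contMDiff_const.prodMk contMDiff_id).contMDiffOn fun _ ht => ⟨hu, ht⟩, hf0 u hu⟩

theorem IsSmoothFamily.glue (h : IsSmoothFamily IN V ψ) {f : N → ℝ → M}
    (hf : ContMDiffOn (IN.prod 𝓘(ℝ, ℝ)) 𝓘(ℝ, EM) ∞ (fun z : N × ℝ => f z.1 z.2)
      (V ×ˢ Icc (0 : ℝ) 1)) (hf0 : ∀ u ∈ V, f u 0 = (ψ u).endpoint) :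
    IsSmoothFamily IN V (fun u => (ψ u).glue (f u)) :=
  PwSmoothOn.trans h (PwSmoothOn.of_contMDiffOn hf)
    (fun _ hu _ ht => eval_glue_left (attachable_of_contMDiffOn hf hf0 hu) ht.2)
    (fun _ hu _ ht => eval_glue_right (attachable_of_contMDiffOn hf hf0 hu) ht)

theorem IsSmoothFamily.loop {ψ' : N → PwPathSpace EM x₀} (h : IsSmoothFamily IN V ψ)
    (h' : IsSmoothFamily IN V ψ') (he : ∀ u ∈ V, (ψ u).endpoint = (ψ' u).endpoint) :
    IsSmoothFamily IN V (fun u => ofLoop ((ψ u).loop (ψ' u))) :=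
  PwSmoothOn.trans h' (PwSmoothOn.symm h)
    (fun u hu _ ht => eval_ofLoop_loop_left (he u hu) ht.2)
    (fun u hu _ ht => eval_ofLoop_loop_right (he u hu) ht.1)

end PwPathSpace

open PwPathSpace

variable {EG : Type*} [NormedAddCommGroup EG] [NormedSpace ℝ EG]
  {G : Type*} [TopologicalSpace G] [ChartedSpace EG G] [Group G] {H : PwLoopSpace EM x₀ → G}
  [FiniteDimensional ℝ EN] [IN.Boundaryless] [IsManifold IN ∞ N] {V : Set N}

theorem IsHolonomyMap.contMDiffOn (hH : IsHolonomyMap EG H) (hV : IsOpen V)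
    {Ω : N → PwLoopSpace EM x₀} (hΩ : IsSmoothFamily IN V fun u => ofLoop (Ω u)) :
    ContMDiffOn IN 𝓘(ℝ, EG) ∞ (fun u => H (Ω u)) V := by
  intro u₀ hu₀
  refine ContMDiffAt.contMDiffWithinAt ?_
  let e := extChartAt IN u₀
  let L : EN ≃L[ℝ] EuclideanSpace ℝ (Fin (Module.finrank ℝ EN)) := toEuclidean
  let U : Set (EuclideanSpace ℝ (Fin (Module.finrank ℝ EN))) := L.symm ⁻¹' (e.target ∩ e.symm ⁻¹' V)
  have hUo : IsOpen U :=
    ((continuousOn_extChartAt_symm u₀).isOpen_inter_preimage (isOpen_extChartAt_target u₀)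
      hV).preimage L.symm.continuous
  have hθ : ContMDiffOn 𝓘(ℝ, EuclideanSpace ℝ (Fin (Module.finrank ℝ EN))) IN ∞
      (fun z => e.symm (L.symm z)) U :=
    (contMDiffOn_extChartAt_symm u₀).comp L.symm.contDiff.contMDiff.contMDiffOn fun z hz => hz.1
  have hHU := hH.smooth _ U hUo (fun z => Ω (e.symm (L.symm z)))
    (isSmoothFamily_iff_isSmoothFamilyOn.1 (hΩ.comp hθ fun z hz => hz.2))
  have hmem : L (e u₀) ∈ U := by
    simp only [U, mem_preimage, L.symm_apply_apply]
    exact ⟨mem_extChartAt_target u₀, by rwa [mem_preimage, extChartAt_to_inv]⟩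
  have hLe : ContMDiffAt IN 𝓘(ℝ, EuclideanSpace ℝ (Fin (Module.finrank ℝ EN))) ∞
      (fun u => L (e u)) u₀ :=
    L.contDiff.contMDiff.contMDiffAt.comp u₀ contMDiffAt_extChartAt
  refine ((hHU.contMDiffAt (hUo.mem_nhds hmem)).comp u₀ hLe).congr_of_eventuallyEq ?_
  filter_upwards [show e.source ∈ 𝓝 u₀ from extChartAt_source_mem_nhds u₀] with u hu
  rw [Function.comp_apply, L.symm_apply_apply, e.left_inv hu]

theorem IsHolonomyMap.contMDiffOn_loop (hH : IsHolonomyMap EG H) (hV : IsOpen V)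
    {ψ ψ' : N → PwPathSpace EM x₀} (h : IsSmoothFamily IN V ψ) (h' : IsSmoothFamily IN V ψ')
    (he : ∀ u ∈ V, (ψ u).endpoint = (ψ' u).endpoint) :
    ContMDiffOn IN 𝓘(ℝ, EG) ∞ (fun u => H ((ψ u).loop (ψ' u))) V :=
  hH.contMDiffOn hV (h.loop h' he)

end SmoothFamilies

section Classes

variable {EM : Type*} [NormedAddCommGroup EM] [NormedSpace ℝ EM]
  {M : Type*} [TopologicalSpace M] [ChartedSpace EM M] {x₀ : M}
  {EG : Type*} [NormedAddCommGroup EG] [NormedSpace ℝ EG]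
  {G : Type*} [TopologicalSpace G] [ChartedSpace EG G] [Group G] {H : PwLoopSpace EM x₀ → G}

namespace ReconstructedBundle

open PwPathSpace

theorem mk_eq_mk_mul_loop (hH : IsHolonomyMap EG H) {p p' : PwPathSpace EM x₀}
    (h : p.endpoint = p'.endpoint) (g : G) : mk H p g = mk H p' (H (p.loop p') * g) :=
  (mk_eq_mk_iff hH).2 ⟨h, by rw [loop_eq h]⟩

theorem mk_glue_congr (hH : IsHolonomyMap EG H) {p p' : PwPathSpace EM x₀} {g g' : G}
    (h : mk H p g = mk H p' g') (f : ℝ → M) : mk H (p.glue f) g = mk H (p'.glue f) g' := by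
  obtain ⟨y, a⟩ := p
  obtain ⟨y', b⟩ := p'
  obtain ⟨rfl : y = y', hg⟩ := (mk_eq_mk_iff hH).1 h
  by_cases hf : Attachable (⟨y, a⟩ : PwPathSpace EM x₀) f
  · have hf' : Attachable (⟨y, b⟩ : PwPathSpace EM x₀) f := hf
    rw [glue_eq hf, glue_eq hf']
    refine (mk_eq_mk_iff hH).2 ⟨rfl, hg.trans ?_⟩
    exact congrArg (· * g) (hH.map_trans_trans_symm a b _).symm
  · have hf' : ¬ Attachable (⟨y, b⟩ : PwPathSpace EM x₀) f := hf
    rwa [show glue ⟨y, a⟩ f = _ from dif_neg hf, show glue ⟨y, b⟩ f = _ from dif_neg hf']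

theorem mk_contract_eq_mk_glue (hH : IsHolonomyMap EG H) (r : PwPathSpace EM x₀) {i j : ℝ}
    (hi : i ∈ Icc (0 : ℝ) 1) (hj : j ∈ Icc (0 : ℝ) 1) {ρ : ℝ → ℝ} (hρ : Continuous ρ)
    (h0 : ρ 0 = j) (h1 : ρ 1 = i) {f : ℝ → M} (hfρ : ∀ t ∈ Icc (0 : ℝ) 1, f t = r.eval (ρ t))
    (hf : ContMDiffOn 𝓘(ℝ, ℝ) 𝓘(ℝ, EM) ∞ f (Icc 0 1)) (g : G) :
    mk H (r.contract i) g = mk H ((r.contract j).glue f) g := by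
  have hatt : (r.contract j).Attachable f :=
    ⟨hf, (hfρ 0 ⟨le_rfl, zero_le_one⟩).trans (congrArg r.eval h0)⟩
  let R : Path j i :=
    { toFun := fun t => ρ t
      continuous_toFun := by fun_prop
      source' := by simpa using h0
      target' := by simpa using h1 }
  refine mk_eq_mk_of_eq_comp_real hH (Path.segment 0 i) ((Path.segment 0 j).trans R)
    r.continuous_eval (fun t => ?_) (fun t => ?_) g
  · rw [eval_contract r hi t.2]
    simp [AffineMap.lineMap_apply, mul_comm]
  · rw [Path.trans_apply]
    split_ifs with ht
    · rw [eval_glue_left hatt ht, eval_contract r hj ⟨by linarith [t.2.1], by linarith⟩]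
      simp [AffineMap.lineMap_apply, mul_comm]
    · exact (eval_glue_right hatt ⟨(not_le.1 ht).le, t.2.2⟩).trans
        (hfρ _ ⟨by linarith, by linarith [t.2.2]⟩)

theorem mk_glue_const (hH : IsHolonomyMap EG H) (p : PwPathSpace EM x₀) (g : G) :
    mk H (p.glue fun _ => p.endpoint) g = mk H p g := by
  have hatt : p.Attachable fun _ => p.endpoint := ⟨contMDiffOn_const, rfl⟩
  refine mk_eq_mk_of_eq_comp_real hH ((Path.segment 0 1).trans (Path.refl (1 : ℝ)))
    (Path.segment 0 1) p.continuous_eval (fun t => ?_) (fun t => ?_) g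
  · rw [Path.trans_apply]
    split_ifs with ht
    · rw [eval_glue_left hatt ht]
      simp [AffineMap.lineMap_apply]
    · rw [eval_glue_right hatt ⟨(not_le.1 ht).le, t.2.2⟩, Path.refl_apply, eval_one]
  · simp [AffineMap.lineMap_apply]

end ReconstructedBundle

end Classes

section LocalSections

open PwPathSpace

variable {EM : Type*} [NormedAddCommGroup EM] [NormedSpace ℝ EM]
  {M : Type*} [TopologicalSpace M] [ChartedSpace EM M]

/-- A convex open subset of the target of the preferred chart at `x`, whose preimage in the manifold
is a contractible neighbourhood of `x`. -/
structure IsChartBall (x : M) (B : Set EM) : Prop where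
  isOpen : IsOpen B
  convex : Convex ℝ B
  subset : B ⊆ (chartAt EM x).target
  mem : chartAt EM x x ∈ B

theorem exists_isChartBall (x : M) : ∃ B : Set EM, IsChartBall x B := by
  obtain ⟨r, hr, hB⟩ := Metric.isOpen_iff.1 (chartAt EM x).open_target _ (mem_chart_target EM x)
  exact ⟨_, Metric.isOpen_ball, convex_ball _ _, hB, Metric.mem_ball_self hr⟩

/-- The part of the domain of the preferred chart at `x` that lies over `B`. -/
def chartDomain (x : M) (B : Set EM) : Set M := (chartAt EM x).source ∩ chartAt EM x ⁻¹' B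

/-- The curve that is the segment from `y` to `w` in the preferred chart at `x`, parametrized by the
square of the parameter, so that it belongs to the family `chartFan`. -/
def chartSegment (x : M) (y w : EM) (t : ℝ) : M := (chartAt EM x).symm (y + t ^ 2 • (w - y))

theorem chartSegment_zero (x : M) (y w : EM) : chartSegment x y w 0 = (chartAt EM x).symm y := by
  simp [chartSegment]

theorem chartSegment_one (x : M) (y w : EM) : chartSegment x y w 1 = (chartAt EM x).symm w := by
  simp [chartSegment]

theorem chartSegment_self (x : M) (y : EM) (t : ℝ) :
    chartSegment x y y t = (chartAt EM x).symm y := by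
  simp [chartSegment]

theorem contMDiffOn_chart_chartDomain [IsManifold 𝓘(ℝ, EM) ∞ M] {x : M} {B : Set EM} :
    ContMDiffOn 𝓘(ℝ, EM) 𝓘(ℝ, EM) ∞ (chartAt EM x) (chartDomain x B) :=
  contMDiffOn_chart.mono inter_subset_left

namespace IsChartBall

variable {x : M} {B : Set EM}

theorem isOpen_chartDomain (h : IsChartBall x B) : IsOpen (chartDomain x B) :=
  (chartAt EM x).isOpen_inter_preimage h.isOpen

theorem mem_chartDomain (h : IsChartBall x B) : x ∈ chartDomain x B :=
  ⟨mem_chart_source EM x, h.mem⟩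

theorem symm_mem (h : IsChartBall x B) {w : EM} (hw : w ∈ B) :
    (chartAt EM x).symm w ∈ chartDomain x B :=
  ⟨(chartAt EM x).map_target (h.subset hw), by
    rwa [mem_preimage, (chartAt EM x).right_inv (h.subset hw)]⟩

theorem contractibleSpace (h : IsChartBall x B) : ContractibleSpace (chartDomain x B) := by
  have := h.convex.contractibleSpace ⟨_, h.mem⟩
  let e : chartDomain x B ≃ₜ B :=
    { toFun := fun u => ⟨chartAt EM x u, u.2.2⟩
      invFun := fun w => ⟨(chartAt EM x).symm w, h.symm_mem w.2⟩
      left_inv := fun u => Subtype.ext ((chartAt EM x).left_inv u.2.1)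
      right_inv := fun w => Subtype.ext ((chartAt EM x).right_inv (h.subset w.2))
      continuous_toFun := ((chartAt EM x).continuousOn.comp_continuous continuous_subtype_val
        fun u => u.2.1).subtype_mk _
      continuous_invFun := ((chartAt EM x).continuousOn_symm.comp_continuous
        continuous_subtype_val fun w => h.subset w.2).subtype_mk _ }
  exact e.contractibleSpace

variable [IsManifold 𝓘(ℝ, EM) ∞ M]

theorem contMDiffOn_chartSegment (h : IsChartBall x B) :
    ContMDiffOn 𝓘(ℝ, (EM × EM) × ℝ) 𝓘(ℝ, EM) ∞
      (fun z : (EM × EM) × ℝ => chartSegment x z.1.1 z.1.2 z.2) ((B ×ˢ B) ×ˢ Icc 0 1) := by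
  have hseg : ContDiff ℝ ∞ fun z : (EM × EM) × ℝ => z.1.1 + z.2 ^ 2 • (z.1.2 - z.1.1) := by
    fun_prop
  exact contMDiffOn_chart_symm.comp hseg.contMDiff.contMDiffOn fun z hz =>
    h.subset (h.convex.add_smul_sub_mem hz.1.1 hz.1.2
      ⟨by positivity, pow_le_one₀ hz.2.1 hz.2.2⟩)

end IsChartBall

/-- The path `p`, prolonged by the segment to the point with coordinates `w` in the preferred chart
at `x`. -/
noncomputable def PwPathSpace.glueSegment {x₀ : M} (p : PwPathSpace EM x₀) (x : M) (w : EM) :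
    PwPathSpace EM x₀ :=
  p.glue (chartSegment x (chartAt EM x p.endpoint) w)

section Families

variable {EN : Type*} [NormedAddCommGroup EN] [NormedSpace ℝ EN]
  {HN : Type*} [TopologicalSpace HN] {IN : ModelWithCorners ℝ EN HN}
  {N : Type*} [TopologicalSpace N] [ChartedSpace HN N] [IsManifold 𝓘(ℝ, EM) ∞ M]
  {x₀ x : M} {B : Set EM}

namespace PwPathSpace

theorem IsSmoothFamily.glueSegment (h : IsChartBall x B) {V : Set N} {ψ : N → PwPathSpace EM x₀}
    (hψ : IsSmoothFamily IN V ψ) (hV : ∀ u ∈ V, (ψ u).endpoint ∈ chartDomain x B) {w : N → EM}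
    (hw : ContMDiffOn IN 𝓘(ℝ, EM) ∞ w V) (hwB : MapsTo w V B) :
    IsSmoothFamily IN V fun u => (ψ u).glueSegment x (w u) := by
  refine hψ.glue (h.contMDiffOn_chartSegment.comp
    (((contMDiffOn_chart_chartDomain.comp hψ.endpoint hV).prodMk_space hw).comp contMDiffOn_fst
      (fun z hz => hz.1) |>.prodMk_space contMDiffOn_snd)
    fun z hz => ⟨⟨(hV _ hz.1).2, hwB hz.1⟩, hz.2⟩) fun u hu => ?_
  rw [chartSegment_zero, (chartAt EM x).left_inv (hV u hu).1]

theorem attachable_chartSegment (h : IsChartBall x B) {p : PwPathSpace EM x₀}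
    (hp : p.endpoint ∈ chartDomain x B) {w : EM} (hw : w ∈ B) :
    p.Attachable (chartSegment x (chartAt EM x p.endpoint) w) :=
  ⟨h.contMDiffOn_chartSegment.comp
      ((contMDiffOn_const (c := (chartAt EM x p.endpoint, w))).prodMk_space contMDiffOn_id)
    fun _ ht => ⟨⟨hp.2, hw⟩, ht⟩, by rw [chartSegment_zero, (chartAt EM x).left_inv hp.1]⟩

theorem endpoint_glueSegment (h : IsChartBall x B) {p : PwPathSpace EM x₀}
    (hp : p.endpoint ∈ chartDomain x B) {w : EM} (hw : w ∈ B) :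
    (p.glueSegment x w).endpoint = (chartAt EM x).symm w :=
  (endpoint_glue (attachable_chartSegment h hp hw)).trans (chartSegment_one _ _ _)

theorem exists_endpoint_eq [PreconnectedSpace M] (x₀ y : M) :
    ∃ p : PwPathSpace EM x₀, p.endpoint = y := by
  let A : Set M := {y | ∃ p : PwPathSpace EM x₀, p.endpoint = y}
  have hA {x : M} {B : Set EM} (h : IsChartBall x B) {y : M} (hy : y ∈ chartDomain x B) {z : M}
      (hz : z ∈ chartDomain x B) (hyA : y ∈ A) : z ∈ A := by
    obtain ⟨p, rfl⟩ := hyA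
    exact ⟨p.glueSegment x (chartAt EM x z), by
      rw [endpoint_glueSegment h hy hz.2, (chartAt EM x).left_inv hz.1]⟩
  have hclopen : IsClopen A := by
    constructor
    · refine isClosed_of_closure_subset fun x hx => ?_
      obtain ⟨B, h⟩ := exists_isChartBall (EM := EM) x
      obtain ⟨y, hy, hyA⟩ := mem_closure_iff.1 hx _ h.isOpen_chartDomain h.mem_chartDomain
      exact hA h hy h.mem_chartDomain hyA
    · refine isOpen_iff_mem_nhds.2 fun x hx => ?_
      obtain ⟨B, h⟩ := exists_isChartBall (EM := EM) x
      filter_upwards [h.isOpen_chartDomain.mem_nhds h.mem_chartDomain] with y hy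
      exact hA h h.mem_chartDomain hy hx
  exact (hclopen.eq_univ ⟨x₀, ⟨x₀, PwPath.refl x₀⟩, rfl⟩).ge (mem_univ y)

end PwPathSpace

variable (EM) in
/-- A smooth family of paths `ψ[u]` with `ψ[u](1) = u`, over an open subset of `M`. -/
structure LocalSection (x₀ : M) where
  base : Set M
  isOpen : IsOpen base
  toFun : M → PwPathSpace EM x₀
  smooth : IsSmoothFamily 𝓘(ℝ, EM) base toFun
  endpoint_eq : ∀ u ∈ base, (toFun u).endpoint = u

theorem exists_localSection [PreconnectedSpace M] (x₀ : M) (h : IsChartBall x B) :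
    ∃ s : LocalSection EM x₀, s.base = chartDomain x B := by
  obtain ⟨p, rfl⟩ := exists_endpoint_eq (EM := EM) x₀ x
  refine ⟨⟨chartDomain p.endpoint B, h.isOpen_chartDomain, fun u =>
    p.glueSegment p.endpoint (chartAt EM p.endpoint u), (isSmoothFamily_const _ p).glueSegment h
      (fun _ _ => h.mem_chartDomain) contMDiffOn_chart_chartDomain fun u hu => hu.2,
    fun u hu => ?_⟩, rfl⟩
  rw [endpoint_glueSegment h h.mem_chartDomain hu.2, (chartAt EM _).left_inv hu.1]

end Families

end LocalSections

section Parametrizations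

variable {𝕜 : Type*} [NontriviallyNormedField 𝕜] {E : Type*} [NormedAddCommGroup E]
  [NormedSpace 𝕜 E] {K : Type*} [TopologicalSpace K] {I₀ : ModelWithCorners 𝕜 E K} {n : ℕ∞ω}
  {X : Type*} [TopologicalSpace X] [ChartedSpace K X] {Q ι : Type*}

variable (I₀ n) in
/-- A family of bijections of open subsets of a manifold `X` with subsets of a set `Q` that cover
`Q`, with smooth changes of parametrization: the data that make `Q` into a manifold. -/
structure IsParametrization (Ψ : ι → PartialEquiv X Q) : Prop where
  isOpen_trans_source : ∀ i j, IsOpen ((Ψ i).trans (Ψ j).symm).source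
  contMDiffOn_trans : ∀ i j, ContMDiffOn I₀ I₀ n ((Ψ i).trans (Ψ j).symm)
    ((Ψ i).trans (Ψ j).symm).source
  exists_mem_target : ∀ q, ∃ i, q ∈ (Ψ i).target

theorem isManifold_of_chartedSpaceCore (c : ChartedSpaceCore K Q)
    (h : ∀ e ∈ c.atlas, ∀ e' ∈ c.atlas, ContMDiffOn I₀ I₀ n (e.symm.trans e')
      (e.symm.trans e').source) :
    letI := c.toTopologicalSpace
    letI := c.toChartedSpace
    IsManifold I₀ n Q := by
  let _ : TopologicalSpace Q := c.toTopologicalSpace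
  let _ : ChartedSpace K Q := c.toChartedSpace
  have hatlas (e : OpenPartialHomeomorph Q K) (he : e ∈ atlas K Q) :
      e.toPartialEquiv ∈ c.atlas := by
    obtain ⟨e', he', hee'⟩ := mem_iUnion₂.1 he
    rwa [mem_singleton_iff.1 hee']
  refine isManifold_of_contDiffOn _ _ _ fun e e' he he' => contMDiffOn_iff_contDiffOn.1 ?_
  exact I₀.contMDiff.comp_contMDiffOn ((h _ (hatlas e he) _ (hatlas e' he')).comp
    (I₀.contMDiffOn_symm.mono inter_subset_right) fun w hw => hw.1)

variable (K) in
/-- The chart of `Q` that comes from a parametrization by `X` and the preferred chart of `X` at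
`x`. -/
def paramChart (Ψ : PartialEquiv X Q) (x : X) : PartialEquiv Q K :=
  Ψ.symm.trans (chartAt K x).toPartialEquiv

theorem paramChart_symm_trans (Ψ Ψ' : PartialEquiv X Q) (x x' : X) :
    (paramChart K Ψ x).symm.trans (paramChart K Ψ' x') =
      ((chartAt K x).symm.toPartialEquiv.trans (Ψ.trans Ψ'.symm)).trans
        (chartAt K x').toPartialEquiv := by
  simp [paramChart, PartialEquiv.trans_symm_eq_symm_trans_symm, PartialEquiv.trans_assoc]

section MaximalAtlas

variable [IsManifold I₀ n X] [TopologicalSpace Q] [ChartedSpace K Q] {Ψ : PartialEquiv X Q}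
  {e : OpenPartialHomeomorph Q K} {x : X}

theorem contMDiffOn_of_paramChart_mem_maximalAtlas (he : e ∈ IsManifold.maximalAtlas I₀ n Q)
    (heΨ : e.toPartialEquiv = paramChart K Ψ x) :
    ContMDiffOn I₀ I₀ n Ψ ((chartAt K x).source ∩ Ψ.source) := by
  have htarget : e.target = (chartAt K x).target ∩ (chartAt K x).symm ⁻¹' Ψ.source :=
    congrArg PartialEquiv.target heΨ
  have hsymm (w : K) : e.symm w = Ψ ((chartAt K x).symm w) :=
    congrArg (fun f : PartialEquiv Q K => f.symm w) heΨ
  refine ((contMDiffOn_symm_of_mem_maximalAtlas he).comp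
    (contMDiffOn_chart.mono inter_subset_left) fun x' hx' => ?_).congr fun x' hx' => ?_
  · rw [htarget]
    refine ⟨(chartAt K x).map_source hx'.1, ?_⟩
    rw [mem_preimage, (chartAt K x).left_inv hx'.1]
    exact hx'.2
  · rw [Function.comp_apply, hsymm, (chartAt K x).left_inv hx'.1]

theorem contMDiffOn_symm_of_paramChart_mem_maximalAtlas [IsManifold I₀ n Q]
    (he : e ∈ IsManifold.maximalAtlas I₀ n Q) (heΨ : e.toPartialEquiv = paramChart K Ψ x) :
    ContMDiffOn I₀ I₀ n Ψ.symm e.source := by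
  have hsource : e.source = Ψ.target ∩ Ψ.symm ⁻¹' (chartAt K x).source :=
    congrArg PartialEquiv.source heΨ
  have hcoe (q : Q) : e q = chartAt K x (Ψ.symm q) :=
    congrArg (fun f : PartialEquiv Q K => f q) heΨ
  refine ((contMDiffOn_chart_symm (x := x)).comp (contMDiffOn_of_mem_maximalAtlas he)
    fun q hq => ?_).congr fun q hq => ?_
  · rw [mem_preimage, hcoe]
    exact (chartAt K x).map_source (hsource ▸ hq).2
  · rw [Function.comp_apply, hcoe, (chartAt K x).left_inv (hsource ▸ hq).2]

theorem exists_partialDiffeomorph_of_paramChart_mem_maximalAtlas [IsManifold I₀ n Q]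
    (hΨ : IsOpen Ψ.source)
    (h : ∀ x, ∃ e ∈ IsManifold.maximalAtlas I₀ n Q, e.toPartialEquiv = paramChart K Ψ x) :
    ∃ Φ : PartialDiffeomorph I₀ I₀ X Q n, Φ.toPartialEquiv = Ψ := by
  choose e hemax heΨ using h
  have hsource (x : X) : (e x).source = Ψ.target ∩ Ψ.symm ⁻¹' (chartAt K x).source :=
    congrArg PartialEquiv.source (heΨ x)
  have hnhds {q : Q} (hq : q ∈ Ψ.target) : (e (Ψ.symm q)).source ∈ 𝓝 q :=
    (e _).open_source.mem_nhds (hsource _ ▸ ⟨hq, mem_chart_source K _⟩)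
  refine ⟨{ toPartialEquiv := Ψ
            open_source := hΨ
            open_target := isOpen_iff_mem_nhds.2 fun q hq => ?_
            contMDiffOn_toFun := fun x hx => ?_
            contMDiffOn_invFun := fun q hq => ?_ }, rfl⟩
  · exact Filter.mem_of_superset (hnhds hq) (hsource _ ▸ inter_subset_left)
  · exact ((contMDiffOn_of_paramChart_mem_maximalAtlas (hemax x) (heΨ x)).contMDiffAt
      (((chartAt K x).open_source.inter hΨ).mem_nhds
        ⟨mem_chart_source K x, hx⟩)).contMDiffWithinAt
  · exact ((contMDiffOn_symm_of_paramChart_mem_maximalAtlas (hemax _) (heΨ _)).contMDiffAt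
      (hnhds hq)).contMDiffWithinAt

end MaximalAtlas

namespace IsParametrization

variable {Ψ : ι → PartialEquiv X Q}

theorem isOpen_source (h : IsParametrization I₀ n Ψ) (i : ι) : IsOpen (Ψ i).source := by
  have := h.isOpen_trans_source i i
  rwa [PartialEquiv.trans_source, PartialEquiv.symm_source,
    inter_eq_left.2 (Ψ i).source_subset_preimage_target] at this

theorem isOpen_paramChart_symm_trans_source (h : IsParametrization I₀ n Ψ) (i j : ι) (x x' : X) :
    IsOpen ((paramChart K (Ψ i) x).symm.trans (paramChart K (Ψ j) x')).source := by
  rw [paramChart_symm_trans, PartialEquiv.trans_source, PartialEquiv.trans_source, inter_assoc,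
    PartialEquiv.coe_trans, preimage_comp, ← preimage_inter]
  exact (chartAt K x).isOpen_inter_preimage_symm
    ((h.contMDiffOn_trans i j).continuousOn.isOpen_inter_preimage (h.isOpen_trans_source i j)
      (chartAt K x').open_source)

theorem contMDiffOn_paramChart_symm_trans [IsManifold I₀ n X] (h : IsParametrization I₀ n Ψ)
    (i j : ι) (x x' : X) :
    ContMDiffOn I₀ I₀ n ((paramChart K (Ψ i) x).symm.trans (paramChart K (Ψ j) x'))
      ((paramChart K (Ψ i) x).symm.trans (paramChart K (Ψ j) x')).source := by
  rw [paramChart_symm_trans]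
  exact contMDiffOn_chart.comp ((h.contMDiffOn_trans i j).comp
    (contMDiffOn_chart_symm.mono fun w hw => hw.1.1) fun w hw => hw.1.2) fun w hw => hw.2

theorem exists_mem_paramChart_source (h : IsParametrization I₀ n Ψ) (q : Q) :
    ∃ i x, q ∈ (paramChart K (Ψ i) x).source :=
  let ⟨i, hi⟩ := h.exists_mem_target q
  ⟨i, (Ψ i).symm q, hi, mem_chart_source K _⟩

/-- The atlas of `Q` that consists of the charts of the parametrizations. -/
noncomputable def chartedSpaceCore [IsManifold I₀ n X] (h : IsParametrization I₀ n Ψ) :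
    ChartedSpaceCore K Q where
  atlas := {e | ∃ i x, e = paramChart K (Ψ i) x}
  chartAt q := paramChart K (Ψ (h.exists_mem_paramChart_source q).choose)
    (h.exists_mem_paramChart_source q).choose_spec.choose
  mem_chart_source q := (h.exists_mem_paramChart_source q).choose_spec.choose_spec
  chart_mem_atlas _ := ⟨_, _, rfl⟩
  open_source := by
    rintro _ _ ⟨i, x, rfl⟩ ⟨j, x', rfl⟩
    exact h.isOpen_paramChart_symm_trans_source i j x x'
  continuousOn_toFun := by
    rintro _ _ ⟨i, x, rfl⟩ ⟨j, x', rfl⟩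
    exact (h.contMDiffOn_paramChart_symm_trans i j x x').continuousOn

theorem exists_isManifold [IsManifold I₀ n X] (h : IsParametrization I₀ n Ψ) :
    ∃ (_ : TopologicalSpace Q) (_ : ChartedSpace K Q) (_ : IsManifold I₀ n Q),
      ∀ i, ∃ Φ : PartialDiffeomorph I₀ I₀ X Q n, Φ.toPartialEquiv = Ψ i := by
  let c := h.chartedSpaceCore
  let _ : TopologicalSpace Q := c.toTopologicalSpace
  let _ : ChartedSpace K Q := c.toChartedSpace
  have hQ : IsManifold I₀ n Q := by
    refine isManifold_of_chartedSpaceCore c ?_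
    rintro _ ⟨i, x, rfl⟩ _ ⟨j, x', rfl⟩
    exact h.contMDiffOn_paramChart_symm_trans i j x x'
  refine ⟨_, _, hQ, fun i => exists_partialDiffeomorph_of_paramChart_mem_maximalAtlas
    (h.isOpen_source i) fun x => ?_⟩
  exact ⟨c.openPartialHomeomorph _ ⟨i, x, rfl⟩,
    IsManifold.subset_maximalAtlas (mem_iUnion₂.2 ⟨_, ⟨i, x, rfl⟩, rfl⟩), rfl⟩

end IsParametrization

end Parametrizations

section Trivializations

open PwPathSpace ReconstructedBundle

variable {EM : Type*} [NormedAddCommGroup EM] [NormedSpace ℝ EM]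
  {M : Type*} [TopologicalSpace M] [ChartedSpace EM M] {x₀ : M}

namespace LocalSection

theorem proj_triv {G : Type*} [Group G] {H : PwLoopSpace EM x₀ → G} (s : LocalSection EM x₀)
    {z : M × G} (hz : z.1 ∈ s.base) : (triv H s.toFun z).proj = z.1 :=
  s.endpoint_eq _ hz

variable {EG : Type*} [NormedAddCommGroup EG] [NormedSpace ℝ EG]
  {G : Type*} [TopologicalSpace G] [ChartedSpace EG G] [Group G] {H : PwLoopSpace EM x₀ → G}
  (s s' : LocalSection EM x₀)

variable (H) in
/-- The change of trivialization between two smooth families of paths. -/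
noncomputable def transition (z : M × G) : M × G :=
  (z.1, H ((s.toFun z.1).loop (s'.toFun z.1)) * z.2)

theorem contMDiffOn_transition [FiniteDimensional ℝ EM] [IsManifold 𝓘(ℝ, EM) ∞ M]
    [LieGroup 𝓘(ℝ, EG) ∞ G] (hH : IsHolonomyMap EG H) :
    ContMDiffOn (𝓘(ℝ, EM).prod 𝓘(ℝ, EG)) (𝓘(ℝ, EM).prod 𝓘(ℝ, EG)) ∞ (s.transition H s')
      ((s.base ∩ s'.base) ×ˢ univ) := by
  have h := hH.contMDiffOn_loop (s.isOpen.inter s'.isOpen)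
    (s.smooth.mono inter_subset_left) (s'.smooth.mono inter_subset_right)
    fun u hu => (s.endpoint_eq u hu.1).trans (s'.endpoint_eq u hu.2).symm
  exact contMDiffOn_fst.prodMk ((h.comp contMDiffOn_fst fun z hz => hz.1).mul contMDiffOn_snd)

theorem bijOn_triv (hH : IsHolonomyMap EG H) :
    BijOn (triv H s.toFun) (s.base ×ˢ univ) (proj ⁻¹' s.base) := by
  refine ⟨fun z hz => ?_, ?_, fun a ha => ?_⟩
  · rw [mem_preimage, s.proj_triv hz.1]
    exact hz.1
  · rintro ⟨u, g⟩ hz ⟨u', g'⟩ hz' h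
    obtain rfl : u = u' := (s.proj_triv hz.1).symm.trans
      ((congrArg proj h).trans (s.proj_triv hz'.1))
    exact congrArg (Prod.mk u) (mk_injective hH _ h)
  · obtain ⟨g, hg⟩ := exists_eq_mk a (s.toFun a.proj) (s.endpoint_eq _ ha)
    exact ⟨(a.proj, g), ⟨ha, mem_univ _⟩, hg.symm⟩

variable (hH : IsHolonomyMap EG H)

/-- The local trivialization `C_ψ`, as a bijection of `U × G` with `π⁻¹(U)`. -/
noncomputable def trivEquiv : PartialEquiv (M × G) (ReconstructedBundle H) :=
  haveI : Nonempty (M × G) := ⟨(x₀, 1)⟩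
  (s.bijOn_triv hH).toPartialEquiv

theorem trivEquiv_trans_symm_source :
    ((s.trivEquiv hH).trans (s'.trivEquiv hH).symm).source = (s.base ∩ s'.base) ×ˢ univ := by
  ext z
  rw [PartialEquiv.trans_source]
  refine ⟨fun ⟨hz, hz'⟩ => ⟨⟨hz.1, ?_⟩, trivial⟩, fun hz => ⟨⟨hz.1.1, trivial⟩, ?_⟩⟩
  · rw [← s.proj_triv hz.1]
    exact hz'
  · have := hz.1.2
    rwa [← s.proj_triv (H := H) hz.1.1] at this

theorem eqOn_trivEquiv_trans_symm :
    EqOn ((s.trivEquiv hH).trans (s'.trivEquiv hH).symm) (s.transition H s')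
      ((s.base ∩ s'.base) ×ˢ univ) := fun z hz => by
  have h : triv H s.toFun z = s'.trivEquiv hH (s.transition H s' z) :=
    mk_eq_mk_mul_loop hH ((s.endpoint_eq _ hz.1.1).trans (s'.endpoint_eq _ hz.1.2).symm) _
  exact (congrArg _ h).trans ((s'.trivEquiv hH).left_inv ⟨hz.1.2, trivial⟩)

end LocalSection

variable {EG : Type*} [NormedAddCommGroup EG] [NormedSpace ℝ EG]
  {G : Type*} [TopologicalSpace G] [ChartedSpace EG G] [Group G] {H : PwLoopSpace EM x₀ → G}
  [FiniteDimensional ℝ EM] [IsManifold 𝓘(ℝ, EM) ∞ M] [PreconnectedSpace M]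
  [LieGroup 𝓘(ℝ, EG) ∞ G] (hH : IsHolonomyMap EG H)

theorem isParametrization_trivEquiv :
    IsParametrization (𝓘(ℝ, EM).prod 𝓘(ℝ, EG)) ∞
      fun s : LocalSection EM x₀ => s.trivEquiv hH where
  isOpen_trans_source s s' := by
    rw [s.trivEquiv_trans_symm_source s' hH]
    exact (s.isOpen.inter s'.isOpen).prod isOpen_univ
  contMDiffOn_trans s s' := by
    rw [s.trivEquiv_trans_symm_source s' hH]
    exact (s.contMDiffOn_transition s' hH).congr (s.eqOn_trivEquiv_trans_symm s' hH)
  exists_mem_target a := by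
    obtain ⟨B, h⟩ := exists_isChartBall (EM := EM) a.proj
    obtain ⟨s, hs⟩ := exists_localSection x₀ h
    exact ⟨s, (hs ▸ h.mem_chartDomain : a.proj ∈ s.base)⟩

include hH in
theorem exists_hasReconstructedCharts :
    ∃ (_ : TopologicalSpace (ReconstructedBundle H))
       (_ : ChartedSpace (ModelProd EM EG) (ReconstructedBundle H))
       (_ : IsManifold (𝓘(ℝ, EM).prod 𝓘(ℝ, EG)) ∞ (ReconstructedBundle H)),
      HasReconstructedCharts EG H := by
  obtain ⟨_, _, hmf, hdiffeo⟩ := (isParametrization_trivEquiv hH).exists_isManifold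
  refine ⟨_, _, hmf, fun U hU _ ψ hψ hend => ?_⟩
  obtain ⟨Φ, hΦ⟩ := hdiffeo ⟨U, hU, ψ, isSmoothFamily_iff_isSmoothFamilyOn.2 hψ, hend⟩
  exact ⟨Φ, congrArg PartialEquiv.source hΦ, congrArg PartialEquiv.target hΦ,
    fun z _ => congrArg (fun e : PartialEquiv _ _ => e z) hΦ⟩

end Trivializations

section Calculus

open Filter Asymptotics

variable {E : Type*} [NormedAddCommGroup E] [NormedSpace ℝ E]

theorem hasDerivAt_integral_pow_smul {f : ℝ → E} (hf : ContDiff ℝ 1 f) (k : ℕ) (s : ℝ) :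
    HasDerivAt (fun s => ∫ u in (0 : ℝ)..1, u ^ k • f (u * s))
      (∫ u in (0 : ℝ)..1, u ^ (k + 1) • deriv f (u * s)) s := by
  have := hf.continuous_deriv le_rfl
  obtain ⟨C, hC⟩ := ((isCompact_Icc (a := (0 : ℝ)) (b := 1)).prod
    (isCompact_closedBall s 1)).exists_bound_of_continuousOn
    (f := fun z : ℝ × ℝ => z.1 ^ (k + 1) • deriv f (z.1 * z.2)) (by fun_prop)
  have hc : ∀ x : ℝ, Continuous fun u : ℝ => u ^ k • f (u * x) := fun x => by
    have := hf.continuous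
    fun_prop
  refine (intervalIntegral.hasDerivAt_integral_of_dominated_loc_of_deriv_le
    (F' := fun s u => u ^ (k + 1) • deriv f (u * s))
    (bound := fun _ => C) (Metric.closedBall_mem_nhds s one_pos)
    (Eventually.of_forall fun x => (hc x).aestronglyMeasurable)
    ((hc s).intervalIntegrable _ _) ?_ ?_ (by simp) ?_).2
  · exact Continuous.aestronglyMeasurable (by fun_prop)
  · refine Eventually.of_forall fun u hu x hx => hC (u, x) ⟨?_, hx⟩
    rw [uIoc_of_le zero_le_one] at hu
    exact ⟨hu.1.le, hu.2⟩
  · refine Eventually.of_forall fun u _ x _ => ?_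
    have hderiv : HasDerivAt f (deriv f (u * x)) (u * x) :=
      (hf.differentiable one_ne_zero).differentiableAt.hasDerivAt
    have hmul : HasDerivAt (fun x : ℝ => u * x) u x := by
      simpa using (hasDerivAt_id x).const_mul u
    have hscomp := (hderiv.scomp x hmul).const_smul (u ^ k)
    rwa [smul_smul, ← pow_succ] at hscomp

theorem contDiff_integral_pow_smul {f : ℝ → E} (hf : ContDiff ℝ ∞ f) (k : ℕ) :
    ContDiff ℝ ∞ (fun s => ∫ u in (0 : ℝ)..1, u ^ k • f (u * s)) := by
  rw [contDiff_infty]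
  intro n
  induction n generalizing f k with
  | zero =>
    rw [Nat.cast_zero, contDiff_zero]
    exact continuous_iff_continuousAt.2 fun s =>
      (hasDerivAt_integral_pow_smul (hf.of_le (by simp)) k s).continuousAt
  | succ n ih =>
    have h : deriv (fun s => ∫ u in (0 : ℝ)..1, u ^ k • f (u * s)) =
        fun s => ∫ u in (0 : ℝ)..1, u ^ (k + 1) • deriv f (u * s) :=
      funext fun s => (hasDerivAt_integral_pow_smul (hf.of_le (by simp)) k s).deriv
    rw [Nat.cast_succ, contDiff_succ_iff_deriv, h]
    refine ⟨fun s => (hasDerivAt_integral_pow_smul (hf.of_le (by simp)) k s).differentiableAt,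
      by simp, ih (contDiff_infty_iff_deriv.1 hf).2 (k + 1)⟩

theorem exists_contDiff_eq_add_smul [CompleteSpace E] {f : ℝ → E} (hf : ContDiff ℝ ∞ f) :
    ∃ g : ℝ → E, ContDiff ℝ ∞ g ∧ ∀ s, f s = f 0 + s • g s := by
  refine ⟨_, contDiff_integral_pow_smul (contDiff_infty_iff_deriv.1 hf).2 0, fun s => ?_⟩
  have h : ∀ u ∈ uIcc (0 : ℝ) 1, HasDerivAt (fun u : ℝ => f (u * s)) (s • deriv f (u * s)) u := by
    intro u _
    have hderiv : HasDerivAt f (deriv f (u * s)) (u * s) :=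
      (contDiff_infty_iff_deriv.1 hf).1.differentiableAt.hasDerivAt
    have hmul : HasDerivAt (fun u : ℝ => u * s) s u := by
      simpa using (hasDerivAt_id u).mul_const s
    exact hderiv.scomp u hmul
  have hc : Continuous fun u : ℝ => s • deriv f (u * s) := by
    have := (contDiff_infty_iff_deriv.1 hf).2.continuous
    fun_prop
  have := intervalIntegral.integral_eq_sub_of_hasDerivAt h (hc.intervalIntegrable _ _)
  rw [intervalIntegral.integral_smul] at this
  simp only [pow_zero, one_smul]
  rw [this]
  simp

theorem exists_contDiff_eq_add_sq_smul_of_even [CompleteSpace E] {f : ℝ → E}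
    (hf : ContDiff ℝ ∞ f) (heven : ∀ s, f (-s) = f s) :
    ∃ g : ℝ → E, ContDiff ℝ ∞ g ∧ ∀ s, f s = f 0 + s ^ 2 • g s := by
  obtain ⟨g, hg, hfg⟩ := exists_contDiff_eq_add_smul hf
  have hodd : EqOn (fun s => g s + g (-s)) 0 {0}ᶜ := fun s hs => by
    have h := heven s
    rw [hfg s, hfg (-s), add_right_inj, neg_smul, neg_eq_iff_add_eq_zero, ← smul_add,
      add_comm] at h
    exact (smul_eq_zero.1 h).resolve_left hs
  have hg0 : g 0 = 0 := by
    have hcont : Continuous fun s => g s + g (-s) := by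
      have := hg.continuous
      fun_prop
    have h := congrFun (hcont.ext_on (dense_compl_singleton 0) continuous_zero hodd) 0
    simp only [neg_zero, Pi.zero_apply, ← two_smul ℝ] at h
    exact (smul_eq_zero.1 h).resolve_left two_ne_zero
  obtain ⟨g₂, hg₂, hgg₂⟩ := exists_contDiff_eq_add_smul hg
  refine ⟨g₂, hg₂, fun s => ?_⟩
  rw [hfg s, hgg₂ s, hg0, zero_add, smul_smul, sq]

/-- An even smooth map of the real line onto `[0,1)`. It turns one-sided smoothness at `0` into
smoothness: `γ ∘ foldLine` is smooth if `γ` is smooth on `[0,1]`. -/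
noncomputable def foldLine (s : ℝ) : ℝ := s ^ 2 / (1 + s ^ 2)

theorem foldLine_zero : foldLine 0 = 0 := by simp [foldLine]

theorem foldLine_neg (s : ℝ) : foldLine (-s) = foldLine s := by simp [foldLine]

theorem foldLine_mem_Icc (s : ℝ) : foldLine s ∈ Icc (0 : ℝ) 1 :=
  ⟨by unfold foldLine; positivity,
    (div_le_one (by positivity)).2 (le_add_of_nonneg_left zero_le_one)⟩

theorem contDiff_foldLine : ContDiff ℝ ∞ foldLine :=
  (contDiff_id.pow 2).div (contDiff_const.add (contDiff_id.pow 2)) fun s => by positivity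

theorem foldLine_sqrt {t : ℝ} (ht : t ∈ Ico (0 : ℝ) 1) : foldLine √(t / (1 - t)) = t := by
  have hpos : 0 < 1 - t := sub_pos.2 ht.2
  rw [foldLine, Real.sq_sqrt (div_nonneg ht.1 hpos.le)]
  field_simp
  ring

variable {F F' : Type*} [NormedAddCommGroup F] [NormedSpace ℝ F] [NormedAddCommGroup F']
  [NormedSpace ℝ F']

/-- The second component need not be differentiable: strict differentiability makes the derivative
along the first component locally uniform in the second one. -/
theorem hasDerivWithinAt_comp_prodMk_of_eventually_const {f : F × F' → E} {f' : F × F' →L[ℝ] E}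
    {α : ℝ → F} {β : ℝ → F'} {α' : F} {S : Set ℝ} {t₀ : ℝ}
    (hf : HasStrictFDerivAt f f' (α t₀, β t₀))
    (hconst : ∀ᶠ y in 𝓝 (β t₀), f (α t₀, y) = f (α t₀, β t₀))
    (hα : HasDerivWithinAt α α' S t₀) (hβ : ContinuousWithinAt β S t₀) :
    HasDerivWithinAt (fun t => f (α t, β t)) (f' (α', 0)) S t₀ := by
  have hlim : Tendsto (fun t => ((α t, β t), (α t₀, β t))) (𝓝[S] t₀)
      (𝓝 ((α t₀, β t₀), (α t₀, β t₀))) :=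
    (hα.continuousWithinAt.tendsto.prodMk_nhds hβ).prodMk_nhds
      (tendsto_const_nhds.prodMk_nhds hβ)
  have hstrict : (fun t => f (α t, β t) - f (α t₀, β t) - f' (α t - α t₀, 0))
      =o[𝓝[S] t₀] fun t => t - t₀ := by
    have h := (hasStrictFDerivAt_iff_isLittleO.1 hf).comp_tendsto hlim
    simp only [Function.comp_def, Prod.mk_sub_mk, sub_self] at h
    refine h.trans_isBigO (IsBigO.trans ?_ hα.hasFDerivWithinAt.isBigO_sub)
    exact IsBigO.of_bound 1 (Eventually.of_forall fun t => by simp)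
  have hlinear : (fun t => f' (α t - α t₀, 0) - (t - t₀) • f' (α', 0))
      =o[𝓝[S] t₀] fun t => t - t₀ := by
    have := hasDerivWithinAt_iff_isLittleO.1
      ((f'.comp (.inl ℝ F F')).hasFDerivAt.comp_hasDerivWithinAt t₀ hα)
    simpa [← map_sub] using this
  rw [hasDerivWithinAt_iff_isLittleO]
  refine (hstrict.add hlinear).congr' ?_ .rfl
  filter_upwards [hβ.eventually hconst] with t ht
  rw [ht]
  abel

theorem eventuallyEq_of_comp_foldLine {X : Type*} {f : ℝ × ℝ → X} {γ : ℝ → X}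
    (hγ : ∀ s, γ (foldLine s) = f (s ^ 2, s)) :
    γ =ᶠ[𝓝[Icc 0 1] 0] fun t => f (t / (1 - t), √(t / (1 - t))) := by
  filter_upwards [self_mem_nhdsWithin, nhdsWithin_le_nhds (Iio_mem_nhds one_pos)] with t ht0 ht1
  have h := hγ √(t / (1 - t))
  rwa [foldLine_sqrt ⟨ht0.1, ht1⟩, Real.sq_sqrt (div_nonneg ht0.1 (sub_pos.2 ht1).le)] at h

theorem hasDerivWithinAt_div_one_sub :
    HasDerivWithinAt (fun t : ℝ => t / (1 - t)) 1 (Icc 0 1) 0 := by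
  simpa using ((hasDerivAt_id' (0 : ℝ)).fun_div ((hasDerivAt_id' (0 : ℝ)).const_sub 1)
    (by simp)).hasDerivWithinAt

theorem continuousWithinAt_of_comp_foldLine {X : Type*} [TopologicalSpace X] {f : ℝ × ℝ → X}
    {γ : ℝ → X} (hf : ContinuousAt f (0, 0)) (hγ : ∀ s, γ (foldLine s) = f (s ^ 2, s)) :
    ContinuousWithinAt γ (Icc 0 1) 0 := by
  have hα := hasDerivWithinAt_div_one_sub.continuousWithinAt
  refine ContinuousWithinAt.congr_of_eventuallyEq_of_mem ?_ (eventuallyEq_of_comp_foldLine hγ)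
    ⟨le_rfl, zero_le_one⟩
  exact ContinuousAt.comp_continuousWithinAt (by simpa using hf) (hα.prodMk hα.sqrt)

theorem hasDerivWithinAt_of_comp_foldLine {f : ℝ × ℝ → E} {f' : ℝ × ℝ →L[ℝ] E} {γ : ℝ → E}
    (hf : HasStrictFDerivAt f f' (0, 0)) (hconst : ∀ s, f (0, s) = f (0, 0))
    (hγ : ∀ s, γ (foldLine s) = f (s ^ 2, s)) :
    HasDerivWithinAt γ (f' (1, 0)) (Icc 0 1) 0 := by
  have hα := hasDerivWithinAt_div_one_sub
  refine HasDerivWithinAt.congr_of_eventuallyEq_of_mem ?_ (eventuallyEq_of_comp_foldLine hγ)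
    ⟨le_rfl, zero_le_one⟩
  exact hasDerivWithinAt_comp_prodMk_of_eventually_const (by simpa using hf)
    (Eventually.of_forall fun s => by simp [hconst s]) hα hα.continuousWithinAt.sqrt

theorem exists_contDiff_comp_foldLine [CompleteSpace E] {c : ℝ → E}
    (hc : ContDiffOn ℝ ∞ c (Icc 0 1)) :
    ∃ g : ℝ → E, ContDiff ℝ ∞ g ∧ (∀ s, c (foldLine s) = c 0 + s ^ 2 • g s) ∧
      HasDerivWithinAt c (g 0) (Icc 0 1) 0 := by
  obtain ⟨g, hg, hcg⟩ : ∃ g : ℝ → E, ContDiff ℝ ∞ g ∧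
      ∀ s, c (foldLine s) = c 0 + s ^ 2 • g s := by
    simpa only [Function.comp_apply, foldLine_zero] using exists_contDiff_eq_add_sq_smul_of_even
      (hc.comp_contDiff contDiff_foldLine foldLine_mem_Icc) fun s => congrArg c (foldLine_neg s)
  have hf : HasStrictFDerivAt (fun z : ℝ × ℝ => c 0 + z.1 • g z.2) _ (0, 0) :=
    (hasStrictFDerivAt_fst.smul ((hg.contDiffAt.hasStrictFDerivAt (by simp)).comp (0, 0)
      hasStrictFDerivAt_snd)).const_add (c 0)
  refine ⟨g, hg, hcg, ?_⟩
  simpa using hasDerivWithinAt_of_comp_foldLine hf (fun s => by simp) hcg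

end Calculus

section Transport

open PwPathSpace ReconstructedBundle

variable {EM : Type*} [NormedAddCommGroup EM] [NormedSpace ℝ EM]
  {M : Type*} [TopologicalSpace M] [ChartedSpace EM M] {x₀ : M}
  {EG : Type*} [NormedAddCommGroup EG] [NormedSpace ℝ EG]
  {G : Type*} [TopologicalSpace G] [ChartedSpace EG G] [Group G] {H : PwLoopSpace EM x₀ → G}

/-- Parallel transport of a point of the total space along a segment in the preferred chart at `x`,
to the point with coordinates `w`. -/
noncomputable def chartTransport (hH : IsHolonomyMap EG H) (x : M) (a : ReconstructedBundle H)
    (w : EM) : ReconstructedBundle H :=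
  Quot.lift (fun b : PwPathSpace EM x₀ × G => mk H (b.1.glueSegment x w) b.2)
    (fun b c hbc => by
      rw [glueSegment, glueSegment, ← hbc.choose]
      exact mk_glue_congr hH (Quot.sound hbc) _) a

variable {hH : IsHolonomyMap EG H}

theorem chartTransport_mk (x : M) (p : PwPathSpace EM x₀) (g : G) (w : EM) :
    chartTransport hH x (mk H p g) w = mk H (p.glueSegment x w) g := rfl

theorem chartTransport_act (x : M) (a : ReconstructedBundle H) (g : G) (w : EM) :
    chartTransport hH x (a.act g) w = (chartTransport hH x a w).act g := by
  induction a using Quot.ind with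
  | mk b => rfl

theorem chartTransport_self {x : M} {a : ReconstructedBundle H}
    (ha : a.proj ∈ (chartAt EM x).source) : chartTransport hH x a (chartAt EM x a.proj) = a := by
  induction a using Quot.ind with
  | mk b =>
    have h : chartSegment x (chartAt EM x b.1.endpoint) (chartAt EM x b.1.endpoint) =
        fun _ => b.1.endpoint :=
      funext fun t => (chartSegment_self _ _ _).trans ((chartAt EM x).left_inv ha)
    exact (congrArg (fun f => mk H (b.1.glue f) b.2) h).trans (mk_glue_const hH b.1 b.2)

theorem proj_chartTransport [IsManifold 𝓘(ℝ, EM) ∞ M] {x : M} {B : Set EM} (h : IsChartBall x B)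
    {a : ReconstructedBundle H} (ha : a.proj ∈ chartDomain x B) {w : EM} (hw : w ∈ B) :
    (chartTransport hH x a w).proj = (chartAt EM x).symm w := by
  induction a using Quot.ind with
  | mk b => exact endpoint_glueSegment h ha hw

end Transport

section Bundle

open PwPathSpace

variable {EM : Type*} [NormedAddCommGroup EM] [NormedSpace ℝ EM]
  {M : Type*} [TopologicalSpace M] [ChartedSpace EM M] {x₀ : M}
  {EG : Type*} [NormedAddCommGroup EG] [NormedSpace ℝ EG]
  {G : Type*} [TopologicalSpace G] [ChartedSpace EG G] [Group G]
  {H : PwLoopSpace EM x₀ → G}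
  [TopologicalSpace (ReconstructedBundle H)]
  [ChartedSpace (ModelProd EM EG) (ReconstructedBundle H)]
  [IsManifold 𝓘(ℝ, EM) ∞ M] [PreconnectedSpace M]

namespace ReconstructedBundle.HasReconstructedCharts

theorem exists_localTriv (hC : HasReconstructedCharts EG H) {x : M} {B : Set EM}
    (h : IsChartBall x B) :
    ∃ (s : LocalSection EM x₀) (Φ : PartialDiffeomorph (𝓘(ℝ, EM).prod 𝓘(ℝ, EG))
        (𝓘(ℝ, EM).prod 𝓘(ℝ, EG)) (M × G) (ReconstructedBundle H) ∞),
      s.base = chartDomain x B ∧ Φ.source = s.base ×ˢ univ ∧ Φ.target = proj ⁻¹' s.base ∧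
      EqOn Φ.toFun (triv H s.toFun) (s.base ×ˢ univ) := by
  obtain ⟨s, hs⟩ := exists_localSection x₀ h
  obtain ⟨Φ, hΦ⟩ := hC s.base s.isOpen (hs ▸ h.contractibleSpace) s.toFun
    (isSmoothFamily_iff_isSmoothFamilyOn.1 s.smooth) s.endpoint_eq
  exact ⟨s, Φ, hs, hΦ⟩

theorem exists_coordinates (hC : HasReconstructedCharts EG H) {x : M} {B : Set EM}
    (h : IsChartBall x B) :
    ∃ (s : LocalSection EM x₀) (c : ReconstructedBundle H → M × G),
      s.base = chartDomain x B ∧ IsOpen (proj ⁻¹' s.base : Set (ReconstructedBundle H)) ∧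
      ContMDiffOn (𝓘(ℝ, EM).prod 𝓘(ℝ, EG)) (𝓘(ℝ, EM).prod 𝓘(ℝ, EG)) ∞ c (proj ⁻¹' s.base) ∧
      ∀ a, a.proj ∈ s.base → (c a).1 = a.proj ∧ mk H (s.toFun a.proj) (c a).2 = a := by
  obtain ⟨s, Φ, hs, hsource, htarget, heq⟩ := hC.exists_localTriv h
  refine ⟨s, Φ.invFun, hs, htarget ▸ Φ.open_target, htarget ▸ Φ.contMDiffOn_invFun,
    fun a ha => ?_⟩
  have hat : a ∈ Φ.target := htarget ▸ ha
  have hinv : Φ.invFun a ∈ s.base ×ˢ univ := hsource ▸ Φ.map_target' hat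
  have htriv : triv H s.toFun (Φ.invFun a) = a := (heq hinv).symm.trans (Φ.right_inv' hat)
  have hproj : (Φ.invFun a).1 = a.proj := (s.proj_triv hinv.1).symm.trans (congrArg proj htriv)
  exact ⟨hproj, hproj ▸ htriv⟩

theorem contMDiff_proj (hC : HasReconstructedCharts EG H) :
    ContMDiff (𝓘(ℝ, EM).prod 𝓘(ℝ, EG)) 𝓘(ℝ, EM) ∞ (proj : ReconstructedBundle H → M) := by
  intro a
  obtain ⟨B, h⟩ := exists_isChartBall (EM := EM) a.proj
  obtain ⟨s, c, hs, hopen, hc, hproj⟩ := hC.exists_coordinates h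
  refine ((contMDiff_fst.comp_contMDiffOn hc).congr fun b hb => (hproj b hb).1.symm).contMDiffAt
    (hopen.mem_nhds ?_)
  rw [mem_preimage, hs]
  exact h.mem_chartDomain

variable [LieGroup 𝓘(ℝ, EG) ∞ G]

theorem contMDiffOn_mk (hC : HasReconstructedCharts EG H) (hH : IsHolonomyMap EG H)
    {EN : Type*} [NormedAddCommGroup EN] [NormedSpace ℝ EN] [FiniteDimensional ℝ EN]
    {HN : Type*} [TopologicalSpace HN] {IN : ModelWithCorners ℝ EN HN} [IN.Boundaryless]
    {N : Type*} [TopologicalSpace N] [ChartedSpace HN N] [IsManifold IN ∞ N]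
    {V : Set N} (hV : IsOpen V) {ρ : N → PwPathSpace EM x₀} (hρ : IsSmoothFamily IN V ρ) :
    ContMDiffOn (IN.prod 𝓘(ℝ, EG)) (𝓘(ℝ, EM).prod 𝓘(ℝ, EG)) ∞
      (fun z : N × G => mk H (ρ z.1) z.2) (V ×ˢ univ) := by
  rintro ⟨u₀, g₀⟩ ⟨hu₀, -⟩
  refine ContMDiffAt.contMDiffWithinAt ?_
  obtain ⟨B, h⟩ := exists_isChartBall (EM := EM) (ρ u₀).endpoint
  obtain ⟨s, Φ, hs, hsource, -, heq⟩ := hC.exists_localTriv h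
  let V' := V ∩ (fun u => (ρ u).endpoint) ⁻¹' s.base
  have hV' : IsOpen V' := hρ.endpoint.continuousOn.isOpen_inter_preimage hV s.isOpen
  have hρ' : IsSmoothFamily IN V' ρ := hρ.mono inter_subset_left
  have hu₀' : u₀ ∈ V' := ⟨hu₀, by rw [mem_preimage, hs]; exact h.mem_chartDomain⟩
  have he : ∀ u ∈ V', (ρ u).endpoint = (s.toFun (ρ u).endpoint).endpoint :=
    fun u hu => (s.endpoint_eq _ hu.2).symm
  have hholonomy : ContMDiffOn IN 𝓘(ℝ, EG) ∞
      (fun u => H ((ρ u).loop (s.toFun (ρ u).endpoint))) V' :=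
    hH.contMDiffOn_loop hV' hρ' (s.smooth.comp hρ'.endpoint fun u hu => hu.2) he
  have hcoord : ContMDiffOn (IN.prod 𝓘(ℝ, EG)) (𝓘(ℝ, EM).prod 𝓘(ℝ, EG)) ∞
      (fun z : N × G =>
        ((ρ z.1).endpoint, H ((ρ z.1).loop (s.toFun (ρ z.1).endpoint)) * z.2)) (V' ×ˢ univ) :=
    (hρ'.endpoint.comp contMDiffOn_fst fun z hz => hz.1).prodMk
      ((hholonomy.comp contMDiffOn_fst fun z hz => hz.1).mul contMDiffOn_snd)
  refine ((Φ.contMDiffOn_toFun.comp hcoord fun z hz => ?_).congr fun z hz => ?_).contMDiffAt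
    ((hV'.prod isOpen_univ).mem_nhds ⟨hu₀', mem_univ _⟩)
  · rw [mem_preimage, hsource]
    exact ⟨hz.1.2, mem_univ _⟩
  · exact (mk_eq_mk_mul_loop hH (he _ hz.1) _).trans
      (heq (x := (_, _)) ⟨hz.1.2, mem_univ _⟩).symm

variable [FiniteDimensional ℝ EM]

theorem contMDiff_act (hC : HasReconstructedCharts EG H) (hH : IsHolonomyMap EG H) :
    ContMDiff ((𝓘(ℝ, EM).prod 𝓘(ℝ, EG)).prod 𝓘(ℝ, EG)) (𝓘(ℝ, EM).prod 𝓘(ℝ, EG)) ∞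
      (fun z : ReconstructedBundle H × G => z.1.act z.2) := by
  intro z
  obtain ⟨B, h⟩ := exists_isChartBall (EM := EM) z.1.proj
  obtain ⟨s, c, hs, hopen, hc, hcoord⟩ := hC.exists_coordinates h
  have hz : z.1.proj ∈ s.base := hs ▸ h.mem_chartDomain
  have hc' : ContMDiffOn ((𝓘(ℝ, EM).prod 𝓘(ℝ, EG)).prod 𝓘(ℝ, EG)) (𝓘(ℝ, EM).prod 𝓘(ℝ, EG)) ∞
      (fun z : ReconstructedBundle H × G => c z.1) ((proj ⁻¹' s.base) ×ˢ univ) :=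
    hc.comp contMDiffOn_fst fun z hz => hz.1
  have hsmooth := (hC.contMDiffOn_mk hH s.isOpen s.smooth).comp
    ((hC.contMDiff_proj.comp contMDiff_fst).contMDiffOn.prodMk
      ((contMDiff_snd.comp_contMDiffOn hc').mul contMDiffOn_snd)) fun z hz => ⟨hz.1, mem_univ _⟩
  refine (hsmooth.congr fun w hw => ?_).contMDiffAt
    ((hopen.prod isOpen_univ).mem_nhds ⟨hz, mem_univ _⟩)
  exact congrArg (act · w.2) (hcoord w.1 hw.1).2.symm

theorem contMDiffOn_chartTransport (hC : HasReconstructedCharts EG H) (hH : IsHolonomyMap EG H)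
    {x : M} {B : Set EM} (h : IsChartBall x B) :
    ContMDiffOn ((𝓘(ℝ, EM).prod 𝓘(ℝ, EG)).prod 𝓘(ℝ, EM)) (𝓘(ℝ, EM).prod 𝓘(ℝ, EG)) ∞
      (fun z : ReconstructedBundle H × EM => chartTransport hH x z.1 z.2)
      ((proj ⁻¹' chartDomain x B) ×ˢ B) := by
  obtain ⟨s, c, hs, -, hc, hcoord⟩ := hC.exists_coordinates h
  rw [← hs]
  have hend : ∀ z ∈ s.base ×ˢ B, (s.toFun z.1).endpoint ∈ chartDomain x B := fun z hz => by
    rw [s.endpoint_eq _ hz.1, ← hs]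
    exact hz.1
  have hfam : IsSmoothFamily (𝓘(ℝ, EM).prod 𝓘(ℝ, EM)) (s.base ×ˢ B)
      fun z => (s.toFun z.1).glueSegment x z.2 :=
    IsSmoothFamily.glueSegment h (s.smooth.comp contMDiffOn_fst fun z hz => hz.1)
      hend contMDiffOn_snd fun z hz => hz.2
  have hc' : ContMDiffOn ((𝓘(ℝ, EM).prod 𝓘(ℝ, EG)).prod 𝓘(ℝ, EM)) (𝓘(ℝ, EM).prod 𝓘(ℝ, EG)) ∞
      (fun z : ReconstructedBundle H × EM => c z.1) ((proj ⁻¹' s.base) ×ˢ B) :=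
    hc.comp contMDiffOn_fst fun z hz => hz.1
  have hparam : ContMDiffOn ((𝓘(ℝ, EM).prod 𝓘(ℝ, EG)).prod 𝓘(ℝ, EM))
      ((𝓘(ℝ, EM).prod 𝓘(ℝ, EM)).prod 𝓘(ℝ, EG)) ∞
      (fun z : ReconstructedBundle H × EM => ((z.1.proj, z.2), (c z.1).2))
      ((proj ⁻¹' s.base) ×ˢ B) :=
    ((hC.contMDiff_proj.comp contMDiff_fst).contMDiffOn.prodMk contMDiffOn_snd).prodMk
      (contMDiff_snd.comp_contMDiffOn hc')
  refine ((hC.contMDiffOn_mk hH (s.isOpen.prod h.isOpen) hfam).comp hparam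
    fun z hz => ⟨hz, mem_univ _⟩).congr fun z hz => ?_
  conv_lhs => rw [← (hcoord z.1 hz.1).2]
  rfl

end ReconstructedBundle.HasReconstructedCharts

end Bundle

section Velocities

variable {EP : Type*} [NormedAddCommGroup EP] [NormedSpace ℝ EP]
  {HP : Type*} [TopologicalSpace HP] {IP : ModelWithCorners ℝ EP HP}
  {P : Type*} [TopologicalSpace P] [ChartedSpace HP P]

theorem hasMFDerivWithinAt_toSpanSingleton_iff {κ : ℝ → P} {S : Set ℝ} {j : ℝ} {v : EP} :
    HasMFDerivWithinAt 𝓘(ℝ, ℝ) IP κ S j (ContinuousLinearMap.toSpanSingleton ℝ (M₁ := EP) v) ↔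
      ContinuousWithinAt κ S j ∧
        HasDerivWithinAt (fun i => extChartAt IP (κ j) (κ i)) v S j := by
  have h : HasMFDerivWithinAt 𝓘(ℝ, ℝ) IP κ S j
      (ContinuousLinearMap.toSpanSingleton ℝ (M₁ := EP) v) ↔ ContinuousWithinAt κ S j ∧
      HasFDerivWithinAt (fun i => extChartAt IP (κ j) (κ i))
        (ContinuousLinearMap.toSpanSingleton ℝ v) (S ∩ range id) j := Iff.rfl
  rw [h, range_id, inter_univ, ← hasDerivWithinAt_iff_hasFDerivWithinAt]

theorem hasMFDerivWithinAt_of_comp_lineMap {κ : ℝ → P} {j k : ℝ} (hjk : j ≠ k) {v : EP}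
    (h : HasMFDerivWithinAt 𝓘(ℝ, ℝ) IP (fun t : ℝ => κ (AffineMap.lineMap j k t)) (Icc 0 1) 0
      (ContinuousLinearMap.toSpanSingleton ℝ (M₁ := EP) ((k - j) • v))) :
    HasMFDerivWithinAt 𝓘(ℝ, ℝ) IP κ (uIcc j k) j
      (ContinuousLinearMap.toSpanSingleton ℝ (M₁ := EP) v) := by
  have hkj : k - j ≠ 0 := sub_ne_zero.2 hjk.symm
  have hinv : ∀ i, AffineMap.lineMap j k ((i - j) / (k - j)) = i := fun i => by
    rw [AffineMap.lineMap_apply_ring', div_mul_cancel₀ _ hkj, sub_add_cancel]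
  have hmaps : MapsTo (fun i => (i - j) / (k - j)) (uIcc j k) (Icc 0 1) := by
    rw [← segment_eq_uIcc, segment_eq_image_lineMap]
    rintro _ ⟨t, ht, rfl⟩
    simpa [AffineMap.lineMap_apply_ring', mul_div_cancel_right₀ _ hkj] using ht
  have hφ : HasDerivWithinAt (fun i => (i - j) / (k - j)) (1 / (k - j)) (uIcc j k) j :=
    (((hasDerivAt_id j).sub_const j).div_const (k - j)).hasDerivWithinAt
  have hj : (j - j) / (k - j) = 0 := by rw [sub_self, zero_div]
  obtain ⟨hκ, hκ'⟩ := hasMFDerivWithinAt_toSpanSingleton_iff.1 h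
  refine hasMFDerivWithinAt_toSpanSingleton_iff.2 ⟨?_, ?_⟩
  · simpa only [Function.comp_def, hinv] using hκ.comp_of_eq hφ.continuousWithinAt hmaps hj
  · simpa [Function.comp_def, hinv, smul_smul, hkj] using
      HasDerivWithinAt.scomp_of_eq j hκ' hφ hmaps hj.symm

end Velocities

section OneSided

open PwPathSpace Filter

variable {EM : Type*} [NormedAddCommGroup EM] [NormedSpace ℝ EM]
  {M : Type*} [TopologicalSpace M] [ChartedSpace EM M] {x₀ : M}

theorem PwPathSpace.exists_contMDiffOn_uIcc (r : PwPathSpace EM x₀) {j : ℝ}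
    (hj : j ∈ Icc (0 : ℝ) 1) {U : Set M} (hU : IsOpen U) (hjU : r.eval j ∈ U) :
    ∃ k ∈ Icc (0 : ℝ) 1, k ≠ j ∧ MapsTo r.eval (uIcc j k) U ∧
      ContMDiffOn 𝓘(ℝ, ℝ) 𝓘(ℝ, EM) ∞ r.eval (uIcc j k) := by
  have := nhdsWithin_diff_singleton_neBot ordConnected_Icc ⟨0, by simp, 1, by simp, zero_ne_one⟩ hj
  have hmaps : ∀ᶠ k in 𝓝[Icc 0 1 \ {j}] j, uIcc j k ⊆ r.eval ⁻¹' U :=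
    (tendsto_const_nhds.uIcc (tendsto_id.mono_left nhdsWithin_le_nhds)).eventually
      (eventually_smallSets_subset.2 (r.continuous_eval.continuousAt.preimage_mem_nhds
        (hU.mem_nhds hjU)))
  obtain ⟨k, ⟨hkU, hk⟩, hkI, hkj⟩ := (hmaps.and
    ((isSmoothFamily_const (IN := 𝓘(ℝ, ℝ)) (univ : Set ℝ) r).eventually_contMDiffOn ordConnected_Icc
      hj)).and self_mem_nhdsWithin |>.exists
  exact ⟨k, hkI, hkj, hkU, hk.comp (contMDiff_const (c := (0 : ℝ)).prodMk contMDiff_id).contMDiffOn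
    fun t ht => ⟨mem_univ _, ht⟩⟩

/-- The curves `t ↦ y + τ t² • C (s t)` in the preferred chart at `x`, where `z = (τ, s)`. They are
constant for `τ = 0` and segments for `s = 0`, and for `τ = s²` they run along a curve that is
smooth on one side of its initial point only, in the form of `exists_contDiff_comp_foldLine`. -/
def chartFan (x : M) (y : EM) (C : ℝ → EM) (z : ℝ × ℝ) (t : ℝ) : M :=
  (chartAt EM x).symm (y + (z.1 * t ^ 2) • C (z.2 * t))

section

variable (x : M) (y : EM) (C : ℝ → EM)

theorem chartFan_zero (z : ℝ × ℝ) : chartFan x y C z 0 = (chartAt EM x).symm y := by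
  simp [chartFan]

theorem chartFan_zero_left (s t : ℝ) : chartFan x y C (0, s) t = (chartAt EM x).symm y := by
  simp [chartFan]

theorem chartFan_zero_right (τ : ℝ) :
    chartFan x y C (τ, 0) = chartSegment x y (y + τ • C 0) := by
  ext t
  simp only [chartFan, chartSegment, zero_mul, add_sub_cancel_left, smul_smul, mul_comm τ]

theorem chartFan_sq (s t : ℝ) :
    chartFan x y C (s ^ 2, s) t = (chartAt EM x).symm (y + (s * t) ^ 2 • C (s * t)) := by
  rw [chartFan, mul_pow]

end

theorem IsChartBall.exists_contMDiffOn_chartFan [IsManifold 𝓘(ℝ, EM) ∞ M] {x : M} {B : Set EM}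
    (h : IsChartBall x B) {y : EM} (hy : y ∈ B) {C : ℝ → EM} (hC : ContDiff ℝ ∞ C) :
    ∃ V : Set (ℝ × ℝ), IsOpen V ∧ (0, 0) ∈ V ∧
      ContMDiffOn (𝓘(ℝ, ℝ × ℝ).prod 𝓘(ℝ, ℝ)) 𝓘(ℝ, EM) ∞
        (fun z : (ℝ × ℝ) × ℝ => chartFan x y C z.1 z.2) (V ×ˢ Icc 0 1) := by
  have hW : ContDiff ℝ ∞ fun z : (ℝ × ℝ) × ℝ => y + (z.1.1 * z.2 ^ 2) • C (z.1.2 * z.2) := by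
    fun_prop
  have htube : ∀ᶠ z in 𝓝 ((0, 0) : ℝ × ℝ), ∀ t ∈ Icc (0 : ℝ) 1,
      y + (z.1 * t ^ 2) • C (z.2 * t) ∈ B :=
    isCompact_Icc.eventually_forall_of_forall_eventually fun t _ =>
      hW.continuous.continuousAt.eventually_mem (x := ((0, 0), t))
        (h.isOpen.mem_nhds (by simpa using hy))
  obtain ⟨V, hVB, hV, hV0⟩ := eventually_nhds_iff.1 htube
  exact ⟨V, hV, hV0, contMDiffOn_chart_symm.comp
    (hW.contMDiff.comp (contMDiff_fst.prodMk_space contMDiff_snd)).contMDiffOn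
      fun z hz => h.subset (hVB _ hz.1 _ hz.2)⟩

end OneSided

section Horizontal

open PwPathSpace ReconstructedBundle

variable {EM : Type*} [NormedAddCommGroup EM] [NormedSpace ℝ EM]
  {M : Type*} [TopologicalSpace M] [ChartedSpace EM M] {x₀ : M}
  {EG : Type*} [NormedAddCommGroup EG] [NormedSpace ℝ EG]
  {G : Type*} [TopologicalSpace G] [ChartedSpace EG G] [Group G]
  {H : PwLoopSpace EM x₀ → G}

theorem mk_glue_chartFan_zero_left (hH : IsHolonomyMap EG H) {x : M} {p : PwPathSpace EM x₀}
    (hp : p.endpoint ∈ (chartAt EM x).source) (C : ℝ → EM) (g : G) (s : ℝ) :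
    mk H (p.glue (chartFan x (chartAt EM x p.endpoint) C (0, s))) g = mk H p g := by
  have hconst : chartFan x (chartAt EM x p.endpoint) C (0, s) = fun _ => p.endpoint :=
    funext fun t => (chartFan_zero_left _ _ _ s t).trans ((chartAt EM x).left_inv hp)
  rw [hconst, mk_glue_const hH]

theorem mk_glue_chartFan_zero_right (hH : IsHolonomyMap EG H) (x : M) (p : PwPathSpace EM x₀)
    (C : ℝ → EM) (g : G) (τ : ℝ) :
    mk H (p.glue (chartFan x (chartAt EM x p.endpoint) C (τ, 0))) g =
      chartTransport hH x (mk H p g) (chartAt EM x p.endpoint + τ • C 0) := by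
  rw [chartFan_zero_right, chartTransport_mk, glueSegment]

theorem mk_contract_lineMap_foldLine (hH : IsHolonomyMap EG H) {x : M} {r : PwPathSpace EM x₀}
    {j k : ℝ} (hj : j ∈ Icc (0 : ℝ) 1) (hk : k ∈ Icc (0 : ℝ) 1)
    (hr : ContMDiffOn 𝓘(ℝ, ℝ) 𝓘(ℝ, EM) ∞ r.eval (uIcc j k))
    (hrx : MapsTo r.eval (uIcc j k) (chartAt EM x).source) {C : ℝ → EM}
    (hC : ∀ s, chartAt EM x (r.eval (AffineMap.lineMap j k (foldLine s))) =
      chartAt EM x (r.eval j) + s ^ 2 • C s) (g : G) (s : ℝ) :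
    mk H (r.contract (AffineMap.lineMap j k (foldLine s))) g =
      mk H ((r.contract j).glue
        (chartFan x (chartAt EM x (r.contract j).endpoint) C (s ^ 2, s))) g := by
  have hmem : ∀ s, AffineMap.lineMap j k (foldLine s) ∈ uIcc j k := fun s =>
    (convex_uIcc j k).lineMap_mem left_mem_uIcc right_mem_uIcc (foldLine_mem_Icc s)
  let ρ : ℝ → ℝ := fun t => AffineMap.lineMap j k (foldLine (s * t))
  have hρ : ContDiff ℝ ∞ ρ :=
    (AffineMap.contDiff_lineMap j k).comp (contDiff_foldLine.comp (contDiff_const.mul contDiff_id))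
  have hfρ : ∀ t, chartFan x (chartAt EM x (r.contract j).endpoint) C (s ^ 2, s) t =
      r.eval (ρ t) := fun t => by
    rw [chartFan_sq, ← (chartAt EM x).left_inv (hrx (hmem (s * t))), hC]
    rfl
  refine mk_contract_eq_mk_glue hH r (uIcc_subset_Icc hj hk (hmem s)) hj hρ.continuous
    (by simp [ρ, foldLine_zero]) (by simp [ρ]) (fun t _ => hfρ t) ?_ g
  exact (hr.comp hρ.contMDiff.contMDiffOn fun t _ => hmem (s * t)).congr fun t _ => hfρ t

variable [TopologicalSpace (ReconstructedBundle H)]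
  [ChartedSpace (ModelProd EM EG) (ReconstructedBundle H)]

/-- The horizontal lift to `a` of the tangent vectors of `M`, read in the preferred chart at `x`:
the derivative of the parallel transport of `a` along segments. -/
noncomputable def horizontalLift (hH : IsHolonomyMap EG H) (x : M) (a : ReconstructedBundle H) :
    EM →L[ℝ] EM × EG :=
  mfderiv 𝓘(ℝ, EM) (𝓘(ℝ, EM).prod 𝓘(ℝ, EG)) (chartTransport hH x a) (chartAt EM x a.proj)

variable {hH : IsHolonomyMap EG H} [IsManifold 𝓘(ℝ, EM) ∞ M] [PreconnectedSpace M]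
  [LieGroup 𝓘(ℝ, EG) ∞ G] {x : M} {B : Set EM}

theorem contMDiffAt_mk_glue_chartFan (hC : HasReconstructedCharts EG H) (hH : IsHolonomyMap EG H)
    (h : IsChartBall x B) {p : PwPathSpace EM x₀} (hp : p.endpoint ∈ chartDomain x B)
    {C : ℝ → EM} (hCs : ContDiff ℝ ∞ C) (g : G) :
    ContMDiffAt 𝓘(ℝ, ℝ × ℝ) (𝓘(ℝ, EM).prod 𝓘(ℝ, EG)) ∞
      (fun z => mk H (p.glue (chartFan x (chartAt EM x p.endpoint) C z)) g) (0, 0) := by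
  obtain ⟨V, hV, hV0, hfan⟩ := h.exists_contMDiffOn_chartFan hp.2 hCs
  have hfam : IsSmoothFamily 𝓘(ℝ, ℝ × ℝ) V
      fun z => p.glue (chartFan x (chartAt EM x p.endpoint) C z) :=
    (isSmoothFamily_const V p).glue hfan fun z _ =>
      (chartFan_zero _ _ _ z).trans ((chartAt EM x).left_inv hp.1)
  exact ((hC.contMDiffOn_mk hH hV hfam).comp (contMDiff_id.prodMk contMDiff_const).contMDiffOn
    fun z hz => ⟨hz, mem_univ g⟩).contMDiffAt (hV.mem_nhds hV0)

variable [FiniteDimensional ℝ EM]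

theorem hasMFDerivAt_chartTransport (hC : HasReconstructedCharts EG H) (h : IsChartBall x B)
    {a : ReconstructedBundle H} (ha : a.proj ∈ chartDomain x B) :
    HasMFDerivAt 𝓘(ℝ, EM) (𝓘(ℝ, EM).prod 𝓘(ℝ, EG)) (chartTransport hH x a)
      (chartAt EM x a.proj) (horizontalLift hH x a : EM →L[ℝ] EM × EG) :=
  have hsmooth : ContMDiffOn 𝓘(ℝ, EM) (𝓘(ℝ, EM).prod 𝓘(ℝ, EG)) ∞ (chartTransport hH x a) B :=
    (hC.contMDiffOn_chartTransport hH h).comp (contMDiffOn_const.prodMk contMDiffOn_id)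
      fun _ hw => ⟨ha, hw⟩
  ((hsmooth.contMDiffAt (h.isOpen.mem_nhds ha.2)).mdifferentiableAt (by simp)).hasMFDerivAt

theorem hasFDerivAt_extChartAt_chartTransport (hC : HasReconstructedCharts EG H)
    (h : IsChartBall x B) {a : ReconstructedBundle H} (ha : a.proj ∈ chartDomain x B) :
    HasFDerivAt
      (fun w => extChartAt (𝓘(ℝ, EM).prod 𝓘(ℝ, EG)) a (chartTransport hH x a w))
      (horizontalLift hH x a) (chartAt EM x a.proj) := by
  have hderiv : HasFDerivWithinAt (fun w => extChartAt (𝓘(ℝ, EM).prod 𝓘(ℝ, EG))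
      (chartTransport hH x a (chartAt EM x a.proj)) (chartTransport hH x a w))
      (horizontalLift hH x a) (range id) (chartAt EM x a.proj) :=
    (hasMFDerivAt_chartTransport hC h ha).2
  rwa [chartTransport_self ha.1, range_id, hasFDerivWithinAt_univ] at hderiv

theorem exists_hasStrictFDerivAt_mk_glue_chartFan (hC : HasReconstructedCharts EG H)
    (h : IsChartBall x B) {p : PwPathSpace EM x₀} (hp : p.endpoint ∈ chartDomain x B)
    {C : ℝ → EM} (hCs : ContDiff ℝ ∞ C) (g : G) :
    ∃ F' : ℝ × ℝ →L[ℝ] EM × EG, HasStrictFDerivAt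
      (fun z => extChartAt (𝓘(ℝ, EM).prod 𝓘(ℝ, EG)) (mk H p g)
        (mk H (p.glue (chartFan x (chartAt EM x p.endpoint) C z)) g)) F' (0, 0) ∧
      F' (1, 0) = horizontalLift hH x (mk H p g) (C 0) := by
  have hF : ContDiffAt ℝ ∞ (fun z => extChartAt (𝓘(ℝ, EM).prod 𝓘(ℝ, EG)) (mk H p g)
      (mk H (p.glue (chartFan x (chartAt EM x p.endpoint) C z)) g)) (0, 0) := by
    refine contMDiffAt_iff_contDiffAt.1 (ContMDiffAt.comp (I' := 𝓘(ℝ, EM).prod 𝓘(ℝ, EG)) _ ?_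
      (contMDiffAt_mk_glue_chartFan hC hH h hp hCs g))
    rw [mk_glue_chartFan_zero_left hH hp.1]
    exact contMDiffAt_extChartAt
  have hF' := hF.hasStrictFDerivAt (by simp)
  refine ⟨_, hF', ?_⟩
  have hsection : HasDerivAt (fun τ : ℝ => ((τ, 0) : ℝ × ℝ)) (1, 0) 0 :=
    (hasDerivAt_id (0 : ℝ)).prodMk (hasDerivAt_const _ _)
  have hsegment : HasDerivAt (fun τ : ℝ => chartAt EM x p.endpoint + τ • C 0) (C 0) 0 := by
    simpa using ((hasDerivAt_id (0 : ℝ)).smul_const (C 0)).const_add (chartAt EM x p.endpoint)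
  have hlift := (hasFDerivAt_extChartAt_chartTransport (hH := hH) (a := mk H p g) hC h
    hp).comp_hasDerivAt_of_eq (0 : ℝ) hsegment (by simp; rfl)
  refine (hF'.hasFDerivAt.comp_hasDerivAt_of_eq (0 : ℝ) hsection rfl).unique ?_
  simpa only [Function.comp_def, mk_glue_chartFan_zero_right hH] using hlift

theorem hasMFDerivWithinAt_mk_contract (hC : HasReconstructedCharts EG H)
    (h : IsChartBall x B) {r : PwPathSpace EM x₀} {j k : ℝ} (hj : j ∈ Icc (0 : ℝ) 1)
    (hk : k ∈ Icc (0 : ℝ) 1) (hjk : j ≠ k) (hrx : MapsTo r.eval (uIcc j k) (chartDomain x B))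
    (hr : ContMDiffOn 𝓘(ℝ, ℝ) 𝓘(ℝ, EM) ∞ r.eval (uIcc j k)) {w : EM}
    (hw : HasDerivWithinAt (fun i => chartAt EM x (r.eval i)) w (uIcc j k) j) (g : G) :
    HasMFDerivWithinAt 𝓘(ℝ, ℝ) (𝓘(ℝ, EM).prod 𝓘(ℝ, EG)) (fun i => mk H (r.contract i) g)
      (uIcc j k) j (ContinuousLinearMap.toSpanSingleton ℝ (M₁ := EM × EG)
        (horizontalLift hH x (mk H (r.contract j) g) w)) := by
  have hp : (r.contract j).endpoint ∈ chartDomain x B := hrx left_mem_uIcc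
  have hmaps : MapsTo (AffineMap.lineMap j k : ℝ → ℝ) (Icc 0 1) (uIcc j k) := fun t ht =>
    (convex_uIcc j k).lineMap_mem left_mem_uIcc right_mem_uIcc ht
  have hchart : ContDiffOn ℝ ∞ (fun i => chartAt EM x (r.eval i)) (uIcc j k) :=
    contMDiffOn_iff_contDiffOn.1 (contMDiffOn_chart_chartDomain.comp hr hrx)
  obtain ⟨C, hCs, hcC, hwC⟩ := exists_contDiff_comp_foldLine
    (hchart.comp (AffineMap.contDiff_lineMap j k).contDiffOn hmaps)
  simp only [Function.comp_apply, AffineMap.lineMap_apply_zero] at hcC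
  have hC0 : C 0 = (k - j) • w := (uniqueDiffOn_Icc_zero_one 0 ⟨le_rfl, zero_le_one⟩).eq_deriv _
    hwC (hw.scomp_of_eq (0 : ℝ) AffineMap.hasDerivWithinAt_lineMap hmaps (by simp))
  obtain ⟨F', hF, hF'⟩ := exists_hasStrictFDerivAt_mk_glue_chartFan (hH := hH) hC h hp hCs g
  have hfan := mk_contract_lineMap_foldLine hH hj hk hr (fun t ht => (hrx ht).1) hcC g
  refine hasMFDerivWithinAt_of_comp_lineMap hjk (hasMFDerivWithinAt_toSpanSingleton_iff.2
    ⟨continuousWithinAt_of_comp_foldLine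
      (contMDiffAt_mk_glue_chartFan hC hH h hp hCs g).continuousAt hfan, ?_⟩)
  rw [← map_smul, ← hC0, ← hF']
  simp only [AffineMap.lineMap_apply_zero]
  refine hasDerivWithinAt_of_comp_foldLine hF (fun s => ?_) fun s => congrArg _ (hfan s)
  simp only [mk_glue_chartFan_zero_left hH hp.1]

theorem mem_range_horizontalLift (hC : HasReconstructedCharts EG H) (h : IsChartBall x B)
    {r : PwPathSpace EM x₀} {g : G} {j : ℝ} (hj : j ∈ Icc (0 : ℝ) 1)
    (hjx : r.eval j ∈ chartDomain x B) {v : EM × EG}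
    (hv : HasMFDerivWithinAt 𝓘(ℝ, ℝ) (𝓘(ℝ, EM).prod 𝓘(ℝ, EG)) (fun i => mk H (r.contract i) g)
      (Icc 0 1) j (ContinuousLinearMap.toSpanSingleton ℝ (M₁ := EM × EG) v)) :
    v ∈ range (horizontalLift hH x (mk H (r.contract j) g)) := by
  obtain ⟨k, hk, hkj, hrx, hr⟩ := r.exists_contMDiffOn_uIcc hj h.isOpen_chartDomain hjx
  obtain ⟨w, hw⟩ : ∃ w, HasDerivWithinAt (fun i => chartAt EM x (r.eval i)) w (uIcc j k) j :=
    ⟨_, ((contMDiffOn_iff_contDiffOn.1 (contMDiffOn_chart_chartDomain.comp hr hrx)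
      ).differentiableOn (by simp) j left_mem_uIcc).hasDerivWithinAt⟩
  have hlift := hasMFDerivWithinAt_mk_contract (hH := hH) hC h hj hk hkj.symm hrx hr hw g
  have hunique : UniqueDiffWithinAt ℝ (uIcc j k) j :=
    uniqueDiffOn_Icc (min_lt_max.2 hkj.symm) j left_mem_uIcc
  exact ⟨w, hunique.eq_deriv _ (hasMFDerivWithinAt_toSpanSingleton_iff.1 hlift).2
    ((hasMFDerivWithinAt_toSpanSingleton_iff.1 hv).2.mono (uIcc_subset_Icc hj hk))⟩

end Horizontal

section Distribution

open PwPathSpace ReconstructedBundle Filter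

variable {EM : Type*} [NormedAddCommGroup EM] [NormedSpace ℝ EM]
  {M : Type*} [TopologicalSpace M] [ChartedSpace EM M] {x₀ : M}
  {EG : Type*} [NormedAddCommGroup EG] [NormedSpace ℝ EG]
  {G : Type*} [TopologicalSpace G] [ChartedSpace EG G] [Group G]
  {H : PwLoopSpace EM x₀ → G}
  [TopologicalSpace (ReconstructedBundle H)]
  [ChartedSpace (ModelProd EM EG) (ReconstructedBundle H)]

theorem Γ_eq_span (hH : IsHolonomyMap EG H) (a : ReconstructedBundle H) :
    Γ EG a = Submodule.span ℝ {v | ∃ (r : PwPathSpace EM x₀) (j : ℝ) (g : G),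
      a = mk H (r.contract j) g ∧ j ∈ Icc (0 : ℝ) 1 ∧
        HasMFDerivWithinAt 𝓘(ℝ, ℝ) (𝓘(ℝ, EM).prod 𝓘(ℝ, EG)) (fun i : ℝ => mk H (r.contract i) g)
          (Icc 0 1) j (ContinuousLinearMap.toSpanSingleton ℝ (M₁ := EM × EG) v)} := by
  refine congrArg (Submodule.span ℝ) (Set.ext fun v => ⟨?_, ?_⟩)
  · rintro ⟨p, g, r, j, hj, ha, hj01, hv⟩
    exact ⟨r, j, _, ha.trans ((mk_eq_mk_iff hH).2 ⟨hj, rfl⟩), hj01, hv⟩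
  · rintro ⟨r, j, g, ha, hj01, hv⟩
    refine ⟨r.contract j, g, r, j, rfl, ha, hj01, ?_⟩
    rwa [hH.map_invComp_self, one_mul]

variable [IsManifold 𝓘(ℝ, EM) ∞ M] [PreconnectedSpace M] {x : M} {B : Set EM}

theorem exists_hasDerivWithinAt_of_endpoint_eq (x₀ : M) (h : IsChartBall x B) {y w : EM}
    (hy : y ∈ B) (hw : y + w ∈ B) :
    ∃ r : PwPathSpace EM x₀, r.endpoint = (chartAt EM x).symm y ∧
      MapsTo r.eval (uIcc 1 (1 / 2)) (chartDomain x B) ∧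
      ContMDiffOn 𝓘(ℝ, ℝ) 𝓘(ℝ, EM) ∞ r.eval (uIcc 1 (1 / 2)) ∧
      HasDerivWithinAt (fun i => chartAt EM x (r.eval i)) ((-4 : ℝ) • w) (uIcc 1 (1 / 2)) 1 := by
  obtain ⟨p, hp⟩ := exists_endpoint_eq (EM := EM) x₀ ((chartAt EM x).symm (y + w))
  have hpB : p.endpoint ∈ chartDomain x B := hp ▸ h.symm_mem hw
  have hpy : chartAt EM x p.endpoint = y + w := by
    rw [hp, (chartAt EM x).right_inv (h.subset hw)]
  let c : ℝ → EM := fun i => y + (1 - (2 * i - 1) ^ 2) • w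
  have hc : ContDiff ℝ ∞ c := by fun_prop
  have hc' : HasDerivAt c ((-4 : ℝ) • w) 1 := by
    have hsq := (((((hasDerivAt_id (1 : ℝ)).const_mul 2).sub_const 1).pow 2).const_sub 1)
    refine ((hsq.congr_deriv ?_).smul_const w).const_add y
    norm_num
  rw [uIcc_of_ge (by norm_num)]
  have hcB : MapsTo c (Icc (1 / 2) 1) B := fun i hi =>
    h.convex.add_smul_mem hy hw ⟨by nlinarith [hi.1, hi.2], by nlinarith [hi.1, hi.2]⟩
  have heval : ∀ i ∈ Icc (1 / 2 : ℝ) 1, (p.glueSegment x y).eval i = (chartAt EM x).symm (c i) :=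
    fun i hi => by
      rw [glueSegment, eval_glue_right (attachable_chartSegment h hpB hy) hi, chartSegment, hpy]
      congr 1
      module
  refine ⟨p.glueSegment x y, endpoint_glueSegment h hpB hy,
    fun i hi => heval i hi ▸ h.symm_mem (hcB hi),
    (contMDiffOn_chart_symm.comp hc.contMDiff.contMDiffOn
      fun i hi => h.subset (hcB hi)).congr heval, ?_⟩
  have hchart : ∀ i ∈ Icc (1 / 2 : ℝ) 1, chartAt EM x ((p.glueSegment x y).eval i) = c i :=
    fun i hi => by rw [heval i hi, (chartAt EM x).right_inv (h.subset (hcB hi))]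
  exact hc'.hasDerivWithinAt.congr hchart (hchart 1 (right_mem_Icc.2 (by norm_num)))

variable [LieGroup 𝓘(ℝ, EG) ∞ G] [FiniteDimensional ℝ EM]

theorem smul_horizontalLift_mem_Γ (hC : HasReconstructedCharts EG H) (hH : IsHolonomyMap EG H)
    (h : IsChartBall x B) {a : ReconstructedBundle H} (ha : a.proj ∈ chartDomain x B) {w : EM}
    (hw : chartAt EM x a.proj + w ∈ B) : horizontalLift hH x a ((-4 : ℝ) • w) ∈ Γ EG a := by
  obtain ⟨r, hend, hrx, hr, hderiv⟩ := exists_hasDerivWithinAt_of_endpoint_eq x₀ h ha.2 hw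
  obtain ⟨g, rfl⟩ := exists_eq_mk a (r.contract 1)
    ((eval_one r).trans (hend.trans ((chartAt EM x).left_inv ha.1)))
  have hlift := hasMFDerivWithinAt_mk_contract (hH := hH) hC h (right_mem_Icc.2 zero_le_one)
    (by norm_num) (by norm_num) hrx hr hderiv g
  rw [uIcc_of_ge (by norm_num)] at hlift
  have hnhds : Icc (1 / 2 : ℝ) 1 ∈ 𝓝[Icc 0 1] 1 :=
    nhdsWithin_mono _ Icc_subset_Iic_self (Icc_mem_nhdsLE (by norm_num))
  exact (Γ_eq_span hH _).ge (Submodule.subset_span (M := EM × EG) ⟨r, 1, g, rfl,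
    right_mem_Icc.2 zero_le_one, hlift.mono_of_mem_nhdsWithin hnhds⟩)

theorem horizontalLift_mem_Γ (hC : HasReconstructedCharts EG H) (hH : IsHolonomyMap EG H)
    (h : IsChartBall x B) {a : ReconstructedBundle H} (ha : a.proj ∈ chartDomain x B) (w : EM) :
    horizontalLift hH x a w ∈ Γ EG a := by
  have hline : Tendsto (fun δ : ℝ => chartAt EM x a.proj + δ • w) (𝓝 0)
      (𝓝 (chartAt EM x a.proj)) := Continuous.tendsto' (by fun_prop) _ _ (by simp)
  have hB : ∀ᶠ δ in 𝓝[≠] (0 : ℝ), chartAt EM x a.proj + δ • w ∈ B :=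
    nhdsWithin_le_nhds (hline.eventually_mem (h.isOpen.mem_nhds ha.2))
  obtain ⟨δ, hδB, hδ⟩ := (hB.and self_mem_nhdsWithin).exists
  have hmem : horizontalLift hH x a ((-4 * δ) • w) ∈ Γ EG a := by
    rw [mul_smul]
    exact smul_horizontalLift_mem_Γ hC hH h ha hδB
  rw [map_smul] at hmem
  exact ((Γ EG a).smul_mem_iff (mul_ne_zero (by norm_num) hδ)).1 hmem

theorem Γ_eq_range_horizontalLift (hC : HasReconstructedCharts EG H) (hH : IsHolonomyMap EG H)
    (h : IsChartBall x B) {a : ReconstructedBundle H} (ha : a.proj ∈ chartDomain x B) :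
    Γ EG a = LinearMap.range (horizontalLift hH x a).toLinearMap := by
  refine le_antisymm ?_ ?_
  · rw [Γ_eq_span hH]
    refine Submodule.span_le.2 ?_
    rintro v ⟨r, j, g, rfl, hj, hv⟩
    exact mem_range_horizontalLift hC h hj ha hv
  · rintro _ ⟨w, rfl⟩
    exact horizontalLift_mem_Γ hC hH h ha w

end Distribution

theorem isCompl_range_ker_of_comp_bijective {R V W U : Type*} [Ring R] [AddCommGroup V]
    [Module R V] [AddCommGroup W] [Module R W] [AddCommGroup U] [Module R U] {f : V →ₗ[R] W}
    {q : W →ₗ[R] U} (h : Function.Bijective (q ∘ₗ f)) :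
    IsCompl (LinearMap.range f) (LinearMap.ker q) := by
  constructor
  · rw [Submodule.disjoint_def]
    rintro _ ⟨v, rfl⟩ hv
    rw [h.1 (a₁ := v) (a₂ := 0) (by simpa using hv), map_zero]
  · rw [codisjoint_iff_le_sup]
    intro z _
    obtain ⟨v, hv⟩ := h.2 (q z)
    refine Submodule.mem_sup.2 ⟨f v, ⟨v, rfl⟩, z - f v, ?_, add_sub_cancel _ _⟩
    rw [LinearMap.mem_ker, map_sub, ← hv, LinearMap.comp_apply, sub_self]

section Connection

open ReconstructedBundle

variable {EM : Type*} [NormedAddCommGroup EM] [NormedSpace ℝ EM]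
  {M : Type*} [TopologicalSpace M] [ChartedSpace EM M] [IsManifold 𝓘(ℝ, EM) ∞ M]
  [PreconnectedSpace M] {x₀ : M}
  {EG : Type*} [NormedAddCommGroup EG] [NormedSpace ℝ EG]
  {G : Type*} [TopologicalSpace G] [ChartedSpace EG G] [Group G] [LieGroup 𝓘(ℝ, EG) ∞ G]
  {H : PwLoopSpace EM x₀ → G}
  [TopologicalSpace (ReconstructedBundle H)]
  [ChartedSpace (ModelProd EM EG) (ReconstructedBundle H)] [FiniteDimensional ℝ EM]
  {x : M} {B : Set EM} {a : ReconstructedBundle H}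

theorem mfderiv_chartAt_mfderiv_proj_horizontalLift (hC : HasReconstructedCharts EG H)
    (hH : IsHolonomyMap EG H) (h : IsChartBall x B) (ha : a.proj ∈ chartDomain x B) (w : EM) :
    (mfderiv 𝓘(ℝ, EM) 𝓘(ℝ, EM) (chartAt EM x) a.proj : EM →L[ℝ] EM)
      ((mfderiv (𝓘(ℝ, EM).prod 𝓘(ℝ, EG)) 𝓘(ℝ, EM) (proj : ReconstructedBundle H → M) a :
        EM × EG →L[ℝ] EM) (horizontalLift hH x a w)) = w := by
  have hself := chartTransport_self (hH := hH) ha.1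
  have hT := (hasMFDerivAt_chartTransport (hH := hH) hC h ha).mdifferentiableAt
  have hπ : MDifferentiableAt (𝓘(ℝ, EM).prod 𝓘(ℝ, EG)) 𝓘(ℝ, EM)
      (proj : ReconstructedBundle H → M) a := hC.contMDiff_proj.mdifferentiable (by simp) a
  have hφ : MDifferentiableAt 𝓘(ℝ, EM) 𝓘(ℝ, EM) (chartAt EM x) a.proj :=
    (contMDiffOn_chart_chartDomain.contMDiffAt (h.isOpen_chartDomain.mem_nhds ha)).mdifferentiableAt
      (by simp)
  have hid : chartAt EM x ∘ proj ∘ chartTransport hH x a =ᶠ[𝓝 (chartAt EM x a.proj)] id := by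
    filter_upwards [h.isOpen.mem_nhds ha.2] with w hw
    simp only [Function.comp_apply, id]
    rw [proj_chartTransport h ha hw, (chartAt EM x).right_inv (h.subset hw)]
  have hcomp := mfderiv_comp_apply_of_eq _ hφ (hπ.comp_of_eq _ hT hself) (congrArg proj hself) w
  rw [hid.mfderiv_eq, mfderiv_id] at hcomp
  exact (congrArg (mfderiv 𝓘(ℝ, EM) 𝓘(ℝ, EM) (chartAt EM x) a.proj : EM →L[ℝ] EM)
    (mfderiv_comp_apply_of_eq _ hπ hT hself w)).symm.trans hcomp.symm

theorem mfderiv_proj_comp_horizontalLift_injective (hC : HasReconstructedCharts EG H)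
    (hH : IsHolonomyMap EG H) (h : IsChartBall x B) (ha : a.proj ∈ chartDomain x B) :
    Function.Injective fun w => (mfderiv (𝓘(ℝ, EM).prod 𝓘(ℝ, EG)) 𝓘(ℝ, EM)
      (proj : ReconstructedBundle H → M) a : EM × EG →L[ℝ] EM) (horizontalLift hH x a w) :=
  Function.LeftInverse.injective (g := (mfderiv 𝓘(ℝ, EM) 𝓘(ℝ, EM) (chartAt EM x) a.proj :
    EM →L[ℝ] EM)) (mfderiv_chartAt_mfderiv_proj_horizontalLift hC hH h ha)

theorem horizontalLift_act (hC : HasReconstructedCharts EG H) (hH : IsHolonomyMap EG H)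
    (h : IsChartBall x B) (ha : a.proj ∈ chartDomain x B) (g : G) :
    horizontalLift hH x (a.act g) = (mfderiv (𝓘(ℝ, EM).prod 𝓘(ℝ, EG)) (𝓘(ℝ, EM).prod 𝓘(ℝ, EG))
      (fun b : ReconstructedBundle H => b.act g) a : EM × EG →L[ℝ] EM × EG).comp
        (horizontalLift hH x a) := by
  have hself := chartTransport_self (hH := hH) ha.1
  have hT := (hasMFDerivAt_chartTransport (hH := hH) hC h ha).mdifferentiableAt
  have hR : ContMDiff (𝓘(ℝ, EM).prod 𝓘(ℝ, EG)) (𝓘(ℝ, EM).prod 𝓘(ℝ, EG)) ∞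
      (fun b : ReconstructedBundle H => b.act g) :=
    (hC.contMDiff_act hH).comp (contMDiff_id.prodMk contMDiff_const)
  ext1 w
  have hcomp := mfderiv_comp_apply_of_eq _ (hR.mdifferentiable (by simp) a) hT hself w
  rw [horizontalLift, proj_act]
  rwa [show (fun b : ReconstructedBundle H => b.act g) ∘ chartTransport hH x a =
    chartTransport hH x (a.act g) from funext fun w => (chartTransport_act x a g w).symm] at hcomp

theorem isCompl_Γ_ker_mfderiv_proj (hC : HasReconstructedCharts EG H) (hH : IsHolonomyMap EG H)
    (a : ReconstructedBundle H) :
    IsCompl (Γ EG a) (LinearMap.ker (mfderiv (𝓘(ℝ, EM).prod 𝓘(ℝ, EG)) 𝓘(ℝ, EM)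
      (proj : ReconstructedBundle H → M) a).toLinearMap) := by
  obtain ⟨B, h⟩ := exists_isChartBall (EM := EM) a.proj
  have hinj := mfderiv_proj_comp_horizontalLift_injective hC hH h h.mem_chartDomain
  rw [Γ_eq_range_horizontalLift hC hH h h.mem_chartDomain]
  exact isCompl_range_ker_of_comp_bijective ⟨hinj, LinearMap.injective_iff_surjective.1 hinj⟩

theorem map_mfderiv_act_Γ (hC : HasReconstructedCharts EG H) (hH : IsHolonomyMap EG H)
    (a : ReconstructedBundle H) (g : G) :
    (Γ EG a).map (mfderiv (𝓘(ℝ, EM).prod 𝓘(ℝ, EG)) (𝓘(ℝ, EM).prod 𝓘(ℝ, EG))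
      (fun b : ReconstructedBundle H => b.act g) a).toLinearMap = Γ EG (a.act g) := by
  obtain ⟨B, h⟩ := exists_isChartBall (EM := EM) a.proj
  have ha : (a.act g).proj ∈ chartDomain a.proj B := (proj_act a g).symm ▸ h.mem_chartDomain
  rw [Γ_eq_range_horizontalLift hC hH h h.mem_chartDomain, Γ_eq_range_horizontalLift hC hH h ha,
    horizontalLift_act hC hH h h.mem_chartDomain]
  exact (LinearMap.range_comp _ _).symm

theorem linearIndependent_horizontalLift (hC : HasReconstructedCharts EG H)
    (hH : IsHolonomyMap EG H) (h : IsChartBall x B) (ha : a.proj ∈ chartDomain x B)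
    {ι : Type*} (b : Module.Basis ι ℝ EM) :
    LinearIndependent ℝ fun i => horizontalLift hH x a (b i) :=
  b.linearIndependent.map' (horizontalLift hH x a).toLinearMap <| LinearMap.ker_eq_bot.2
    fun _ _ hw => mfderiv_proj_comp_horizontalLift_injective hC hH h ha (congrArg _ hw)

theorem Γ_eq_span_range_horizontalLift (hC : HasReconstructedCharts EG H)
    (hH : IsHolonomyMap EG H) (h : IsChartBall x B) (ha : a.proj ∈ chartDomain x B)
    {ι : Type*} (b : Module.Basis ι ℝ EM) :
    Γ EG a = Submodule.span ℝ (range fun i => horizontalLift hH x a (b i)) := by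
  rw [Γ_eq_range_horizontalLift hC hH h ha, LinearMap.range_eq_map, ← b.span_eq,
    Submodule.map_span, ← range_comp]
  rfl

variable [IsManifold (𝓘(ℝ, EM).prod 𝓘(ℝ, EG)) ∞ (ReconstructedBundle H)]

theorem contMDiffOn_horizontalLift (hC : HasReconstructedCharts EG H)
    (hH : IsHolonomyMap EG H) (h : IsChartBall x B) (w : EM) :
    ContMDiffOn (𝓘(ℝ, EM).prod 𝓘(ℝ, EG)) (𝓘(ℝ, EM).prod 𝓘(ℝ, EG)).tangent ∞
      (fun b : ReconstructedBundle H => (⟨b, horizontalLift hH x b w⟩ :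
        TangentBundle (𝓘(ℝ, EM).prod 𝓘(ℝ, EG)) (ReconstructedBundle H)))
      (proj ⁻¹' chartDomain x B) := by
  intro a ha
  refine ContMDiffAt.contMDiffWithinAt ?_
  have hV : IsOpen (proj ⁻¹' chartDomain x B : Set (ReconstructedBundle H)) :=
    h.isOpen_chartDomain.preimage hC.contMDiff_proj.continuous
  have hchart : ContMDiffAt (𝓘(ℝ, EM).prod 𝓘(ℝ, EG)) 𝓘(ℝ, EM) ∞
      (fun b : ReconstructedBundle H => chartAt EM x b.proj) a :=
    (contMDiffOn_chart_chartDomain.contMDiffAt (h.isOpen_chartDomain.mem_nhds ha)).comp a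
      hC.contMDiff_proj.contMDiffAt
  have htransport : ContMDiffAt ((𝓘(ℝ, EM).prod 𝓘(ℝ, EG)).prod 𝓘(ℝ, EM))
      (𝓘(ℝ, EM).prod 𝓘(ℝ, EG)) ∞
      (Function.uncurry (chartTransport hH x)) (a, chartAt EM x a.proj) :=
    (hC.contMDiffOn_chartTransport hH h).contMDiffAt ((hV.prod h.isOpen).mem_nhds ⟨ha, ha.2⟩)
  have hmfderiv := ContMDiffAt.mfderiv (m := ∞) (chartTransport hH x)
    (fun b : ReconstructedBundle H => chartAt EM x b.proj) htransport hchart (by simp)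
  have hw : ContMDiff 𝓘(ℝ, EM) 𝓘(ℝ, EM).tangent ∞
      (fun y : EM => (⟨y, w⟩ : TangentBundle 𝓘(ℝ, EM) EM)) :=
    contMDiff_vectorSpace_iff_contDiff.2 contDiff_const
  have hbase : ContMDiffAt (𝓘(ℝ, EM).prod 𝓘(ℝ, EG)) (𝓘(ℝ, EM).prod 𝓘(ℝ, EG)) ∞
      (fun b : ReconstructedBundle H => chartTransport hH x b (chartAt EM x b.proj)) a :=
    htransport.comp a (contMDiffAt_id.prodMk hchart)
  have hlift := ContMDiffAt.clm_apply_of_inCoordinates hmfderiv (hw.contMDiffAt.comp a hchart) hbase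
  refine hlift.congr_of_eventuallyEq ?_
  filter_upwards [hV.mem_nhds ha] with b hb
  exact congrArg (fun c : ReconstructedBundle H => (⟨c, horizontalLift hH x b w⟩ :
    TangentBundle (𝓘(ℝ, EM).prod 𝓘(ℝ, EG)) (ReconstructedBundle H))) (chartTransport_self hb.1).symm

theorem isSmoothConnection_Γ (hC : HasReconstructedCharts EG H) (hH : IsHolonomyMap EG H) :
    IsSmoothConnection (𝓘(ℝ, EM).prod 𝓘(ℝ, EG)) 𝓘(ℝ, EM) (proj : ReconstructedBundle H → M)
      act (Γ EG : (a : ReconstructedBundle H) → _) where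
  isCompl := isCompl_Γ_ker_mfderiv_proj hC hH
  equivariant := map_mfderiv_act_Γ hC hH
  smooth a := by
    obtain ⟨B, h⟩ := exists_isChartBall (EM := EM) a.proj
    exact ⟨proj ⁻¹' chartDomain a.proj B,
      h.isOpen_chartDomain.preimage hC.contMDiff_proj.continuous, h.mem_chartDomain,
      Module.finrank ℝ EM, fun μ b => horizontalLift hH a.proj b (Module.finBasis ℝ EM μ),
      fun μ => contMDiffOn_horizontalLift hC hH h _,
      fun b hb => ⟨linearIndependent_horizontalLift hC hH h hb _,
        Γ_eq_span_range_horizontalLift hC hH h hb _⟩⟩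

end Connection

end HolonomyReconstruction

theorem proposition4p1_general
    {EM : Type*} [NormedAddCommGroup EM] [NormedSpace ℝ EM] [FiniteDimensional ℝ EM]
    {M : Type*} [TopologicalSpace M] [ChartedSpace EM M] [IsManifold 𝓘(ℝ, EM) ∞ M]
    [PreconnectedSpace M]
    {EG : Type*} [NormedAddCommGroup EG] [NormedSpace ℝ EG]
    {G : Type*} [TopologicalSpace G] [ChartedSpace EG G] [Group G] [LieGroup 𝓘(ℝ, EG) ∞ G]
    (x₀ : M) (H : PwLoopSpace EM x₀ → G) (hH : IsHolonomyMap EG H) :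
    (∃ (_ : TopologicalSpace (ReconstructedBundle H))
       (_ : ChartedSpace (ModelProd EM EG) (ReconstructedBundle H))
       (_ : IsManifold (𝓘(ℝ, EM).prod 𝓘(ℝ, EG)) ∞ (ReconstructedBundle H)),
      ReconstructedBundle.HasReconstructedCharts EG H) ∧
    ∀ [TopologicalSpace (ReconstructedBundle H)]
      [ChartedSpace (ModelProd EM EG) (ReconstructedBundle H)]
      [IsManifold (𝓘(ℝ, EM).prod 𝓘(ℝ, EG)) ∞ (ReconstructedBundle H)],
      ReconstructedBundle.HasReconstructedCharts EG H →
        ContMDiff (𝓘(ℝ, EM).prod 𝓘(ℝ, EG)) 𝓘(ℝ, EM) ∞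
          (ReconstructedBundle.proj : ReconstructedBundle H → M) ∧
        ContMDiff ((𝓘(ℝ, EM).prod 𝓘(ℝ, EG)).prod 𝓘(ℝ, EG)) (𝓘(ℝ, EM).prod 𝓘(ℝ, EG)) ∞
          (fun z : ReconstructedBundle H × G => z.1.act z.2) ∧
        IsSmoothConnection (𝓘(ℝ, EM).prod 𝓘(ℝ, EG)) 𝓘(ℝ, EM)
          (ReconstructedBundle.proj : ReconstructedBundle H → M)
          ReconstructedBundle.act
          (ReconstructedBundle.Γ EG : (a : ReconstructedBundle H) → _) :=
  ⟨exists_hasReconstructedCharts hH, fun hC =>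
    ⟨hC.contMDiff_proj, hC.contMDiff_act hH, isSmoothConnection_Γ hC hH⟩⟩

theorem proposition4p1
    {EM : Type*} [NormedAddCommGroup EM] [NormedSpace ℝ EM] [FiniteDimensional ℝ EM]
    {M : Type*} [TopologicalSpace M] [ChartedSpace EM M] [IsManifold 𝓘(ℝ, EM) ∞ M]
    [T2Space M] [ConnectedSpace M]
    {EG : Type*} [NormedAddCommGroup EG] [NormedSpace ℝ EG] [FiniteDimensional ℝ EG]
    {G : Type*} [TopologicalSpace G] [ChartedSpace EG G] [Group G] [LieGroup 𝓘(ℝ, EG) ∞ G]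
    (x₀ : M) (H : PwLoopSpace EM x₀ → G) (hH : IsHolonomyMap EG H) :
    (∃ (_ : TopologicalSpace (ReconstructedBundle H))
       (_ : ChartedSpace (ModelProd EM EG) (ReconstructedBundle H))
       (_ : IsManifold (𝓘(ℝ, EM).prod 𝓘(ℝ, EG)) ∞ (ReconstructedBundle H)),
      ReconstructedBundle.HasReconstructedCharts EG H) ∧
    ∀ [TopologicalSpace (ReconstructedBundle H)]
      [ChartedSpace (ModelProd EM EG) (ReconstructedBundle H)]
      [IsManifold (𝓘(ℝ, EM).prod 𝓘(ℝ, EG)) ∞ (ReconstructedBundle H)],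
      ReconstructedBundle.HasReconstructedCharts EG H →
        ContMDiff (𝓘(ℝ, EM).prod 𝓘(ℝ, EG)) 𝓘(ℝ, EM) ∞
          (ReconstructedBundle.proj : ReconstructedBundle H → M) ∧
        ContMDiff ((𝓘(ℝ, EM).prod 𝓘(ℝ, EG)).prod 𝓘(ℝ, EG)) (𝓘(ℝ, EM).prod 𝓘(ℝ, EG)) ∞
          (fun z : ReconstructedBundle H × G => z.1.act z.2) ∧
        IsSmoothConnection (𝓘(ℝ, EM).prod 𝓘(ℝ, EG)) 𝓘(ℝ, EM)
          (ReconstructedBundle.proj : ReconstructedBundle H → M)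
          ReconstructedBundle.act
          (ReconstructedBundle.Γ EG : (a : ReconstructedBundle H) → _) :=
  proposition4p1_general x₀ H hH
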